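/- Let $d\ge 1$ be an integer, let $\nu\ge 0$, and let $1\le p,q\le\infty$ with Hölder conjugate exponents $p',q'$. Write $\mathbb{R}_+=[0,\infty)$. Let $v=v(t,x)\in L^1_{loc}(\mathbb{R}_+\times\mathbb{R}^d;\mathbb{R}^d)$ be a vector field that is divergence free in the sense of distributions in $x$ for almost every $t$, and that belongs to $L^{p'}(\mathbb{R}_+,\dot W^{1,q'}(\mathbb{R}^d))$; that is, its distributional spatial gradient $\nabla v$ belongs to $L^{p'}(\mathbb{R}_+,L^{q'}(\mathbb{R}^d))$. Let $\varphi_0\in\mathcal D(\mathbb{R}^d)$ be a real-valued, smooth, compactly supported function. Then there exists a real-valued function $\varphi\in L^\infty(\mathbb{R}_+\times\mathbb{R}^d)$ which solves $$\partial_t\varphi-\nabla\cdot(\varphi v)-\nu\Delta\varphi=0,\qquad \varphi(0)=\varphi_0$$ in the sense of distributions, the initial condition being understood in the sense of $\mathcal C^0(\mathbb{R}_+,\mathcal D'(\mathbb{R}^d))$: the map $t\mapsto\int_{\mathbb{R}^d}\varphi(t,x)\chi(x)\,dx$ is continuous on $\mathbb{R}_+$ for every $\chi\in\mathcal D(\mathbb{R}^d)$,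 $\varphi(0)=\varphi_0$ almost everywhere, and for every $\psi\in\mathcal D(\mathbb{R}_+\times\mathbb{R}^d)$ (the restriction to $\mathbb{R}_+\times\mathbb{R}^d$ of a function in $\mathcal D(\mathbb{R}\times\mathbb{R}^d)$) and every $T>0$, $$\int_0^T\!\!\int_{\mathbb{R}^d}\varphi\,\bigl(\partial_t\psi-v\cdot\nabla\psi+\nu\Delta\psi\bigr)\,dx\,dt=\int_{\mathbb{R}^d}\varphi(T,x)\psi(T,x)\,dx-\int_{\mathbb{R}^d}\varphi_0(x)\psi(0,x)\,dx .$$ Moreover, this solution satisfies, for every $t\ge 0$, $$\|\varphi(t)\|_{L^\infty(\mathbb{R}^d)}\le\|\varphi_0\|_{L^\infty(\mathbb{R}^d)} .$$ -/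

import Mathlib

open MeasureTheory Set
open scoped ENNReal ContDiff

namespace AdjointTransport

/-- `ℝ^d` with its Euclidean norm. -/
abbrev Space (d : ℕ) : Type := EuclideanSpace ℝ (Fin d)

/-- The closed half space-time `ℝ₊ × ℝ^d`, with `ℝ₊ = [0, ∞)`. -/
def halfSpaceTime (d : ℕ) : Set (ℝ × Space d) := Ici (0 : ℝ) ×ˢ univ

/-- Smooth compactly supported real functions: the elements of `𝓓(F)`.  Restrictions to
`ℝ₊ × ℝ^d` of elements of `𝓓(ℝ × ℝ^d)` serve as the test functions on `ℝ₊ × ℝ^d`, so that they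
need not vanish at time `0`. -/
structure IsTest {F : Type*} [NormedAddCommGroup F] [NormedSpace ℝ F] (ψ : F → ℝ) : Prop where
  contDiff : ContDiff ℝ ∞ ψ
  hasCompactSupport : HasCompactSupport ψ

/-- `G` is the gradient (Jacobian) of the vector field `u` in the sense of distributions. -/
structure HasWeakGradient {d : ℕ} (u : Space d → Space d)
    (G : Space d → Space d →L[ℝ] Space d) : Prop where
  locallyIntegrable : LocallyIntegrable u volume
  locallyIntegrable_gradient : LocallyIntegrable G volume
  integral_eq : ∀ χ : Space d → ℝ, IsTest χ → ∀ e : Space d,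
    ∫ x, (fderiv ℝ χ x e) • u x = - ∫ x, χ x • G x e

/-- `u` is divergence free in the sense of distributions. -/
def IsWeaklyDivFree {d : ℕ} (u : Space d → Space d) : Prop :=
  ∀ χ : Space d → ℝ, IsTest χ → ∫ x, fderiv ℝ χ x (u x) = 0

/-- `v` belongs to `L^r(ℝ₊, Ẇ^{1,s}(ℝ^d))`: its spatial gradient `G`, in the sense of
distributions, lies in `L^r(ℝ₊, L^s(ℝ^d))`.  Since the gradient determines `v` only up to a
function of time, `v` is required to be an actual locally integrable field on `ℝ₊ × ℝ^d`. -/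
structure MemLpHomSobolev {d : ℕ} (r s : ℝ≥0∞) (v : ℝ → Space d → Space d) : Prop where
  locallyIntegrableOn :
    LocallyIntegrableOn (Function.uncurry v) (halfSpaceTime d) volume
  exists_gradient : ∃ G : ℝ → Space d → Space d →L[ℝ] Space d,
    AEStronglyMeasurable (Function.uncurry G) (volume.restrict (halfSpaceTime d)) ∧
    (∀ᵐ t ∂(volume.restrict (Ici (0 : ℝ))),
      HasWeakGradient (v t) (G t) ∧ MemLp (G t) s volume) ∧
    MemLp (fun t => eLpNorm (G t) s volume) r (volume.restrict (Ici (0 : ℝ)))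

/-- `φ` is a distributional solution on `ℝ₊ × ℝ^d` of the Cauchy problem
`∂ₜφ - ∇·(φ v) - ν Δφ = 0`, `φ(0) = φ₀`, the initial condition being understood in
`C⁰(ℝ₊, 𝓓'(ℝ^d))`. -/
structure IsDistributionalSolution {d : ℕ} (ν : ℝ) (v : ℝ → Space d → Space d)
    (φ₀ : Space d → ℝ) (φ : ℝ → Space d → ℝ) : Prop where
  locallyIntegrableOn :
    LocallyIntegrableOn (Function.uncurry φ) (halfSpaceTime d) volume
  locallyIntegrableOn_flux :
    LocallyIntegrableOn (fun z : ℝ × Space d => φ z.1 z.2 • v z.1 z.2) (halfSpaceTime d) volume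
  locallyIntegrable_slice : ∀ t : ℝ, 0 ≤ t → LocallyIntegrable (φ t) volume
  continuousOn : ∀ χ : Space d → ℝ, IsTest χ →
    ContinuousOn (fun t : ℝ => ∫ x, φ t x * χ x) (Ici 0)
  initial : φ 0 =ᵐ[volume] φ₀
  weak_eq : ∀ ψ : ℝ × Space d → ℝ, IsTest ψ → ∀ T : ℝ, 0 < T →
    ∫ t in (0 : ℝ)..T, ∫ x, φ t x *
        (deriv (fun s : ℝ => ψ (s, x)) t
          - fderiv ℝ (fun y : Space d => ψ (t, y)) x (v t x)
          + ν * Laplacian.laplacian (fun y : Space d => ψ (t, y)) x)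
      = (∫ x, φ T x * ψ (T, x)) - ∫ x, φ₀ x * ψ (0, x)

end AdjointTransport

/-!
Only two properties of `v` matter: it is locally integrable on `ℝ₊ × ℝ^d` and divergence free at
almost every time.  The equation then reads `∂ₜφ = v·∇φ + ν Δφ`, which obeys a maximum principle,
and the solution is a weak-* limit of approximations bounded by `‖φ₀‖_∞`.

*Compactness* (`exists_weakDefect_eq_zero`).  Suppose that functions `φ n`, bounded by `C`, satisfy
the weak formulation up to a defect tending to zero, for each test function `ψ` and each final time
`T`.  A diagonal argument gives weak-* convergence of a subsequence at all rational times.  The weak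
formulation itself makes `t ↦ ∫ φ n t * χ` asymptotically equicontinuous, because the adjoint
operator applied to `ψ` is integrable in space-time; so there is convergence at every time `t ≥ 0`.
The limit at each time is a function bounded by `C`, by the Riesz representation theorem in a
weighted `L²` space, and Lebesgue's differentiation theorem selects a jointly measurable
representative.  Dominated convergence in time makes it an exact solution.

*Smooth fields* (`exists_weakSolution_of_isTest`).  For a smooth compactly supported field `V`, not
necessarily divergence free, the nonconservative equation `∂ₜφ = V·∇φ + ν Δφ` is discretized by
centred finite differences along the coordinate axes, in continuous space and discrete time, with an
artificial viscosity of the order of the space step.  Each value of the scheme is an average of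
previous values, which is the maximum principle.  As translations preserve Lebesgue measure, the
discrete weak formulation is exact, with difference quotients of `ψ` and `V` in place of
derivatives, and it is consistent because these quotients converge boundedly.

*General fields* (`exists_weakSolution`).  Truncating `v` to a large cylinder and mollifying it in
space-time gives smooth fields converging to `v` in `L¹` on bounded sets.  Their divergence vanishes
away from the lateral boundary of the cylinder (`sum_fderiv_mollified_eq_zero`), hence on the
support of any given test function once the cylinder is large.  The adjoint operators therefore converge in
`L¹`, and the compactness statement applies a second time.
-/

namespace AdjointTransport

open Filter Topology Function

/-! ### Weak-* limits of bounded sequences of functions -/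

section WeakStar

variable {α : Type*} [MeasurableSpace α] {μ : Measure α} {C : ℝ}

theorem integrable_bounded_mul {g f : α → ℝ} (hg : AEStronglyMeasurable g μ)
    (hgC : ∀ x, |g x| ≤ C) (hf : Integrable f μ) : Integrable (fun x => g x * f x) μ :=
  hf.bdd_mul hg (Eventually.of_forall hgC)

theorem abs_integral_mul_le {g f : α → ℝ} (hgC : ∀ x, |g x| ≤ C) (hf : Integrable f μ) :
    |∫ x, g x * f x ∂μ| ≤ C * ∫ x, |f x| ∂μ := by
  rw [← integral_const_mul, ← Real.norm_eq_abs]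
  refine norm_integral_le_of_norm_le (hf.abs.const_mul C) (Eventually.of_forall fun x => ?_)
  rw [norm_mul]
  exact mul_le_mul_of_nonneg_right (hgC x) (abs_nonneg _)

theorem abs_integral_mul_sub_le {g f f' : α → ℝ} (hg : AEStronglyMeasurable g μ)
    (hgC : ∀ x, |g x| ≤ C) (hf : Integrable f μ) (hf' : Integrable f' μ) :
    |∫ x, g x * f x ∂μ - ∫ x, g x * f' x ∂μ| ≤ C * ∫ x, |f x - f' x| ∂μ := by
  rw [← integral_sub (integrable_bounded_mul hg hgC hf) (integrable_bounded_mul hg hgC hf')]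
  simp_rw [← mul_sub]
  exact abs_integral_mul_le hgC (hf.sub hf')

/-- For a bounded sequence `g n`, the integrable functions `f` along which `∫ g n * f` is a Cauchy
sequence form a closed subset of `L¹`. -/
theorem cauchySeq_integral_mul_of_approx {g : ℕ → α → ℝ}
    (hg : ∀ n, AEStronglyMeasurable (g n) μ) (hC : 0 ≤ C) (hgC : ∀ n x, |g n x| ≤ C)
    {f : α → ℝ} (hf : Integrable f μ)
    (h : ∀ ε > 0, ∃ f' : α → ℝ, Integrable f' μ ∧ ∫ x, |f x - f' x| ∂μ ≤ ε ∧
      CauchySeq fun n => ∫ x, g n x * f' x ∂μ) :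
    CauchySeq fun n => ∫ x, g n x * f x ∂μ := by
  rw [Metric.cauchySeq_iff]
  intro ε hε
  obtain ⟨f', hf', hff', hcau⟩ := h (ε / (3 * (C + 1))) (by positivity)
  obtain ⟨N, hN⟩ := Metric.cauchySeq_iff.1 hcau (ε / 3) (by positivity)
  have key : ∀ n, |∫ x, g n x * f x ∂μ - ∫ x, g n x * f' x ∂μ| < ε / 3 := fun n => by
    calc _ ≤ C * ∫ x, |f x - f' x| ∂μ := abs_integral_mul_sub_le (hg n) (hgC n) hf hf'
      _ ≤ C * (ε / (3 * (C + 1))) := by gcongr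
      _ < ε / 3 := by
        rw [mul_div_assoc', div_lt_div_iff₀ (by positivity) (by positivity)]
        nlinarith
  refine ⟨N, fun m hm n hn => ?_⟩
  have h1 := hN m hm n hn
  have h2 := key m
  have h3 := key n
  rw [Real.dist_eq] at h1 ⊢
  rw [abs_lt] at *
  constructor <;> linarith [h1.1, h1.2, h2.1, h2.2, h3.1, h3.2]

/-- The integrable functions along which a bounded sequence `g n` converges weakly to a bounded `g'`
form a closed subset of `L¹`. -/
theorem tendsto_integral_mul_of_approx {g : ℕ → α → ℝ} {g' : α → ℝ}
    (hg : ∀ n, AEStronglyMeasurable (g n) μ) (hg' : AEStronglyMeasurable g' μ) (hC : 0 ≤ C)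
    (hgC : ∀ n x, |g n x| ≤ C) (hgC' : ∀ x, |g' x| ≤ C) {f : α → ℝ} (hf : Integrable f μ)
    (h : ∀ ε > 0, ∃ f' : α → ℝ, Integrable f' μ ∧ ∫ x, |f x - f' x| ∂μ ≤ ε ∧
      Tendsto (fun n => ∫ x, g n x * f' x ∂μ) atTop (𝓝 (∫ x, g' x * f' x ∂μ))) :
    Tendsto (fun n => ∫ x, g n x * f x ∂μ) atTop (𝓝 (∫ x, g' x * f x ∂μ)) := by
  obtain ⟨l, hl⟩ := cauchySeq_tendsto_of_complete (cauchySeq_integral_mul_of_approx hg hC hgC hf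
    fun ε hε => (h ε hε).imp fun f' hf' => ⟨hf'.1, hf'.2.1, hf'.2.2.cauchySeq⟩)
  have key : ∀ ε > 0, |l - ∫ x, g' x * f x ∂μ| ≤ ε := by
    intro ε hε
    obtain ⟨f', hf', hff', htend⟩ := h (ε / (2 * (C + 1))) (by positivity)
    have hsmall : C * ∫ x, |f x - f' x| ∂μ ≤ ε / 2 := by
      calc C * ∫ x, |f x - f' x| ∂μ ≤ C * (ε / (2 * (C + 1))) := by gcongr
        _ ≤ ε / 2 := by
          rw [mul_div_assoc', div_le_div_iff₀ (by positivity) (by positivity)]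
          nlinarith
    have h1 : |l - ∫ x, g' x * f' x ∂μ| ≤ ε / 2 :=
      le_of_tendsto' (hl.sub htend).abs fun n =>
        (abs_integral_mul_sub_le (hg n) (hgC n) hf hf').trans hsmall
    have h2 := (abs_integral_mul_sub_le hg' hgC' hf hf').trans hsmall
    rw [abs_le] at *
    constructor <;> linarith [h1.1, h1.2, h2.1, h2.2]
  have : l = ∫ x, g' x * f x ∂μ := by
    have h0 : |l - ∫ x, g' x * f x ∂μ| ≤ 0 :=
      le_of_forall_pos_le_add fun ε hε => by simpa using key ε hε
    linarith [abs_nonpos_iff.1 h0]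
  rwa [this] at hl

/-- Sequential weak-* compactness of the balls of `L^∞`, viewed as the dual of `L¹`.  Multiplication
by a positive square integrable weight `s` sends the sequence to a bounded sequence of the Hilbert
space `L²`, whose weak limit divided by `s` is the function sought. -/
theorem exists_subseq_tendsto_integral_mul [SigmaFinite μ] [IsSeparable μ] {g : ℕ → α → ℝ}
    (hg : ∀ n, Measurable (g n)) (hC : 0 ≤ C) (hgC : ∀ n x, |g n x| ≤ C) :
    ∃ (g' : α → ℝ) (k : ℕ → ℕ), Measurable g' ∧ (∀ x, |g' x| ≤ C) ∧ StrictMono k ∧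
      ∀ f : α → ℝ, Integrable f μ →
        Tendsto (fun n => ∫ x, g (k n) x * f x ∂μ) atTop (𝓝 (∫ x, g' x * f x ∂μ)) := by
  obtain ⟨w, hw_pos, hw_meas, hw_int⟩ := exists_pos_lintegral_lt_of_sigmaFinite μ
    (ε := 1) one_ne_zero
  let s : α → ℝ := fun x => Real.sqrt (w x)
  have hs_pos : ∀ x, 0 < s x := fun x => Real.sqrt_pos.2 (by exact_mod_cast hw_pos x)
  have hs_meas : Measurable s := (measurable_coe_nnreal_real.comp hw_meas).sqrt
  have hs_sq : ∀ x, s x ^ 2 = w x := fun x => Real.sq_sqrt (w x).2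
  have hs : MemLp s 2 μ := by
    rw [memLp_two_iff_integrable_sq hs_meas.aestronglyMeasurable]
    simp_rw [hs_sq]
    refine ⟨(measurable_coe_nnreal_real.comp hw_meas).aestronglyMeasurable, ?_⟩
    simp only [hasFiniteIntegral_iff_enorm]
    simpa [enorm_eq_nnnorm] using hw_int.trans ENNReal.one_lt_top
  have hgs : ∀ n, MemLp (fun x => g n x * s x) 2 μ := fun n =>
    (hs.const_mul C).mono ((hg n).mul hs_meas).aestronglyMeasurable
      (Eventually.of_forall fun x => by
        rw [norm_mul, norm_mul, Real.norm_eq_abs C, abs_of_nonneg hC]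
        exact mul_le_mul_of_nonneg_right (hgC n x) (norm_nonneg _))
  let u : ℕ → Lp ℝ 2 μ := fun n => (hgs n).toLp
  have : Fact ((2 : ℝ≥0∞) ≠ ⊤) := ⟨ENNReal.ofNat_ne_top⟩
  have : SecondCountableTopology (Lp ℝ 2 μ) := Lp.SecondCountableTopology
  let T : ℕ → WeakDual ℝ (Lp ℝ 2 μ) := fun n =>
    StrongDual.toWeakDual (InnerProductSpace.toDual ℝ (Lp ℝ 2 μ) (u n))
  have hT : ∀ n, T n ∈ WeakDual.toStrongDual ⁻¹'
      Metric.closedBall (0 : StrongDual ℝ (Lp ℝ 2 μ)) (C * ‖hs.toLp‖) := by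
    intro n
    change InnerProductSpace.toDual ℝ (Lp ℝ 2 μ) (u n) ∈
      Metric.closedBall (0 : StrongDual ℝ (Lp ℝ 2 μ)) (C * ‖hs.toLp‖)
    rw [mem_closedBall_zero_iff, LinearIsometryEquiv.norm_map]
    refine Lp.norm_le_mul_norm_of_ae_le_mul ?_
    filter_upwards [(hgs n).coeFn_toLp, hs.coeFn_toLp] with x hx hx'
    rw [hx, hx', norm_mul]
    exact mul_le_mul_of_nonneg_right (hgC n x) (norm_nonneg _)
  obtain ⟨A, -, k, hk, hkA⟩ := WeakDual.isSeqCompact_closedBall ℝ (Lp ℝ 2 μ) 0 _ hT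
  let G : Lp ℝ 2 μ := (InnerProductSpace.toDual ℝ (Lp ℝ 2 μ)).symm (WeakDual.toStrongDual A)
  have hG2 : MemLp G 2 μ := Lp.memLp G
  -- weak convergence in `L²` after multiplication by the weight
  have key : ∀ f : α → ℝ, MemLp f 2 μ →
      Tendsto (fun n => ∫ x, g (k n) x * (s x * f x) ∂μ) atTop (𝓝 (∫ x, G x * f x ∂μ)) := by
    intro f hf
    have h1 : Tendsto (fun n => T (k n) hf.toLp) atTop (𝓝 (A hf.toLp)) :=
      ((WeakDual.eval_continuous hf.toLp).tendsto A).comp hkA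
    have h2 : ∀ n, T (k n) hf.toLp = ∫ x, g (k n) x * (s x * f x) ∂μ := by
      intro n
      change inner ℝ (u (k n)) hf.toLp = _
      rw [L2.inner_def]
      refine integral_congr_ae ?_
      filter_upwards [(hgs (k n)).coeFn_toLp, hf.coeFn_toLp] with x hx hx'
      rw [hx, hx']
      simp only [RCLike.inner_apply, conj_trivial]
      ring
    have h3 : A hf.toLp = ∫ x, G x * f x ∂μ := by
      have : A hf.toLp = inner ℝ G hf.toLp := by
        rw [InnerProductSpace.toDual_symm_apply]; rfl
      rw [this, L2.inner_def]
      refine integral_congr_ae ?_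
      filter_upwards [hf.coeFn_toLp] with x hx
      rw [hx]
      simp only [RCLike.inner_apply, conj_trivial]
      ring
    simpa only [h2, h3] using h1
  have hint : ∀ {f : α → ℝ}, MemLp f 2 μ → ∀ E : Set α, MeasurableSet E → μ E < ⊤ →
      IntegrableOn f E μ := fun {f} hf E hE hμE => by
    have : IsFiniteMeasure (μ.restrict E) := ⟨by simpa using hμE⟩
    exact (hf.restrict E).integrable (by norm_num)
  have hset : ∀ E : Set α, MeasurableSet E → μ E < ⊤ →
      Tendsto (fun n => ∫ x in E, g (k n) x * s x ∂μ) atTop (𝓝 (∫ x in E, G x ∂μ)) := by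
    intro E hE hμE
    have h1 : MemLp (E.indicator fun _ => (1 : ℝ)) 2 μ :=
      memLp_indicator_const 2 hE 1 (Or.inr hμE.ne)
    have h2 := key _ h1
    rw [← integral_indicator hE]
    have e1 : (fun x => G x * E.indicator (fun _ => (1 : ℝ)) x) = E.indicator fun x => G x := by
      ext x; by_cases hx : x ∈ E <;> simp [hx]
    rw [e1] at h2
    refine h2.congr fun n => ?_
    rw [← integral_indicator hE]
    refine integral_congr_ae (Eventually.of_forall fun x => ?_)
    by_cases hx : x ∈ E <;> simp [hx]
  have hbound : ∀ᵐ x ∂μ, |G x| ≤ C * s x := by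
    have hCs := hs.const_mul C
    have up : 0 ≤ᵐ[μ] fun x => C * s x - G x := by
      refine ae_nonneg_of_forall_setIntegral_nonneg_of_sigmaFinite
        (fun E hE hμE => hint (hCs.sub hG2) E hE hμE) fun E hE hμE => ?_
      rw [integral_sub (hint hCs E hE hμE) (hint hG2 E hE hμE), sub_nonneg]
      refine le_of_tendsto' (hset E hE hμE) fun n => ?_
      refine integral_mono (hint (hgs _) E hE hμE) (hint hCs E hE hμE) fun x => ?_
      exact mul_le_mul_of_nonneg_right (abs_le.1 (hgC (k n) x)).2 (hs_pos x).le
    have low : 0 ≤ᵐ[μ] fun x => G x + C * s x := by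
      refine ae_nonneg_of_forall_setIntegral_nonneg_of_sigmaFinite
        (fun E hE hμE => hint (hG2.add hCs) E hE hμE) fun E hE hμE => ?_
      rw [integral_add (hint hG2 E hE hμE) (hint hCs E hE hμE), ← neg_le_iff_add_nonneg,
        ← integral_neg]
      refine ge_of_tendsto' (hset E hE hμE) fun n => ?_
      refine integral_mono (hint hCs E hE hμE).neg (hint (hgs _) E hE hμE) fun x => ?_
      have := mul_le_mul_of_nonneg_right (abs_le.1 (hgC (k n) x)).1 (hs_pos x).le
      simpa using this
    filter_upwards [up, low] with x h1 h2
    simp only [Pi.zero_apply] at h1 h2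
    exact abs_le.2 ⟨by linarith, by linarith⟩
  let g' : α → ℝ := fun x => max (-C) (min C (G x / s x))
  have hg'_meas : Measurable g' := measurable_const.max
    (measurable_const.min ((Lp.stronglyMeasurable G).measurable.div hs_meas))
  have hg'C : ∀ x, |g' x| ≤ C := fun x => abs_le.2
    ⟨le_max_left _ _, max_le (by linarith) (min_le_left _ _)⟩
  have hg'G : ∀ᵐ x ∂μ, g' x * s x = G x := by
    filter_upwards [hbound] with x hx
    have h1 : |G x / s x| ≤ C := by
      rw [abs_div, abs_of_pos (hs_pos x)]
      exact (div_le_iff₀ (hs_pos x)).2 hx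
    simp only [g']
    rw [min_eq_right (abs_le.1 h1).2, max_eq_right (abs_le.1 h1).1,
      div_mul_cancel₀ _ (hs_pos x).ne']
  refine ⟨g', k, hg'_meas, hg'C, hk, fun f hf => ?_⟩
  -- it suffices to treat functions dominated by a multiple of `s ^ 2`
  refine tendsto_integral_mul_of_approx (fun n => (hg (k n)).aestronglyMeasurable)
    hg'_meas.aestronglyMeasurable hC (fun n => hgC (k n)) hg'C hf fun ε hε => ?_
  let F : ℕ → α → ℝ := fun m x => max (-(m * s x ^ 2)) (min (m * s x ^ 2) (f x))
  have hms : ∀ (m : ℕ) x, 0 ≤ m * s x ^ 2 := fun m x => by positivity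
  have hF_meas : ∀ m, AEStronglyMeasurable (F m) μ := fun m => by
    have : AEStronglyMeasurable (fun x => (m : ℝ) * s x ^ 2) μ :=
      ((hs_meas.pow_const 2).const_mul (m : ℝ)).aestronglyMeasurable
    exact this.neg.sup (this.inf hf.1)
  have hF_le : ∀ m x, |F m x| ≤ |f x| := fun m x => by
    simp only [F]
    have := hms m x
    rcases le_total 0 (f x) with h | h
    · rw [max_eq_right (le_trans (by linarith) (le_min this h)), abs_of_nonneg (le_min this h),
        abs_of_nonneg h]
      exact min_le_right _ _
    · rw [min_eq_right (h.trans this), abs_of_nonpos h, abs_of_nonpos (max_le (by linarith) h)]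
      linarith [le_max_right (-(m * s x ^ 2)) (f x)]
  have hF_int : ∀ m, Integrable (F m) μ := fun m =>
    hf.mono (hF_meas m) (Eventually.of_forall (hF_le m))
  have hF_lim : ∀ x, Tendsto (fun m => |f x - F m x|) atTop (𝓝 0) := fun x => by
    have hev : ∀ᶠ m : ℕ in atTop, |f x| ≤ m * s x ^ 2 := by
      obtain ⟨m₀, hm₀⟩ := exists_nat_ge (|f x| / s x ^ 2)
      filter_upwards [eventually_ge_atTop m₀] with m hm
      rw [← div_le_iff₀ (by have := hs_pos x; positivity)]
      exact hm₀.trans (by exact_mod_cast hm)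
    refine tendsto_const_nhds.congr' ?_
    filter_upwards [hev] with m hm
    simp only [F]
    rw [min_eq_right (abs_le.1 hm).2, max_eq_right (abs_le.1 hm).1, sub_self, abs_zero]
  have hF_tend : Tendsto (fun m => ∫ x, |f x - F m x| ∂μ) atTop (𝓝 (∫ _, (0 : ℝ) ∂μ)) := by
    refine tendsto_integral_of_dominated_convergence (fun x => 2 * |f x|)
      (fun m => (hf.sub (hF_int m)).abs.1) (hf.abs.const_mul 2)
      (fun m => Eventually.of_forall fun x => ?_) (Eventually.of_forall hF_lim)
    rw [Real.norm_eq_abs, abs_abs]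
    have := norm_sub_le (f x) (F m x)
    simp only [Real.norm_eq_abs] at this
    linarith [hF_le m x]
  rw [integral_zero] at hF_tend
  obtain ⟨m, hm⟩ := (hF_tend.eventually (ge_mem_nhds hε)).exists
  refine ⟨F m, hF_int m, hm, ?_⟩
  have hq : MemLp (fun x => F m x / s x) 2 μ := by
    refine (hs.const_mul (m : ℝ)).mono
      ((hF_meas m).aemeasurable.div hs_meas.aemeasurable).aestronglyMeasurable
      (Eventually.of_forall fun x => ?_)
    have := hs_pos x
    rw [norm_div, norm_mul, Real.norm_natCast, Real.norm_eq_abs, Real.norm_eq_abs,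
      abs_of_pos this, div_le_iff₀ this]
    have h2 : |F m x| ≤ m * s x ^ 2 := abs_le.2
      ⟨le_max_left _ _, max_le (by linarith [hms m x]) (min_le_left _ _)⟩
    linarith [mul_assoc (m : ℝ) (s x) (s x), congrArg (fun r => (m : ℝ) * r) (sq (s x))]
  have h1 := key _ hq
  have e : ∀ h : α → ℝ, (fun x => h x * (s x * (F m x / s x))) = fun x => h x * F m x := fun h => by
    ext x; rw [mul_div_cancel₀ _ (hs_pos x).ne']
  simp only [e] at h1
  convert h1 using 2
  refine integral_congr_ae ?_
  filter_upwards [hg'G] with x hx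
  rw [← hx, mul_assoc, mul_div_cancel₀ _ (hs_pos x).ne']

/-- The weak-* limit of a bounded sequence that is already known to converge weakly along every
integrable function. -/
theorem exists_tendsto_integral_mul_of_cauchySeq [SigmaFinite μ] [IsSeparable μ] {g : ℕ → α → ℝ}
    (hg : ∀ n, Measurable (g n)) (hC : 0 ≤ C) (hgC : ∀ n x, |g n x| ≤ C)
    (hcau : ∀ f : α → ℝ, Integrable f μ → CauchySeq fun n => ∫ x, g n x * f x ∂μ) :
    ∃ g' : α → ℝ, Measurable g' ∧ (∀ x, |g' x| ≤ C) ∧ ∀ f : α → ℝ, Integrable f μ →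
      Tendsto (fun n => ∫ x, g n x * f x ∂μ) atTop (𝓝 (∫ x, g' x * f x ∂μ)) := by
  obtain ⟨g', k, h1, h2, hk, h3⟩ := exists_subseq_tendsto_integral_mul (μ := μ) hg hC hgC
  exact ⟨g', h1, h2, fun f hf =>
    tendsto_nhds_of_cauchySeq_of_subseq (hcau f hf) hk.tendsto_atTop (h3 f hf)⟩

end WeakStar

/-! ### Compactness of asymptotic solutions -/

section Diagonal

variable {α : Type*} [MeasurableSpace α] {μ : Measure α} {C : ℝ}

/-- Diagonal extraction: countably many bounded sequences of functions have a common subsequence of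
indices along which all of them converge weakly. -/
theorem exists_subseq_forall_cauchySeq [IsSeparable μ] {ι : Type*} [Countable ι]
    {g : ℕ → ι → α → ℝ} (hg : ∀ n i, Measurable (g n i)) (hC : 0 ≤ C)
    (hgC : ∀ n i x, |g n i x| ≤ C) :
    ∃ k : ℕ → ℕ, StrictMono k ∧ ∀ i, ∀ f : α → ℝ, Integrable f μ →
      CauchySeq fun n => ∫ x, g (k n) i x * f x ∂μ := by
  have : Fact ((1 : ℝ≥0∞) ≠ ⊤) := ⟨ENNReal.one_ne_top⟩
  have : SecondCountableTopology (Lp ℝ 1 μ) := Lp.SecondCountableTopology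
  let D : ℕ → Lp ℝ 1 μ := TopologicalSpace.denseSeq (Lp ℝ 1 μ)
  have hD : ∀ j, Integrable (D j) μ := fun j => L1.integrable_coeFn (D j)
  -- the sequence of all integrals against a dense sequence of `L¹` lies in a compact product
  let X : ℕ → ι × ℕ → ℝ := fun n p => ∫ x, g n p.1 x * D p.2 x ∂μ
  let B : ℕ → ℝ := fun j => C * ∫ x, |D j x| ∂μ
  have hcomp : IsCompact (Set.univ.pi fun p : ι × ℕ => Icc (-B p.2) (B p.2)) :=
    isCompact_univ_pi fun p => isCompact_Icc
  obtain ⟨Y, -, k, hk, hY⟩ := hcomp.isSeqCompact (x := X) fun n p _ =>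
    abs_le.1 (abs_integral_mul_le (hgC n p.1) (hD p.2))
  refine ⟨k, hk, fun i f hf => cauchySeq_integral_mul_of_approx
    (fun n => (hg (k n) i).aestronglyMeasurable) hC (fun n => hgC (k n) i) hf fun ε hε => ?_⟩
  obtain ⟨j, hj⟩ := (TopologicalSpace.denseRange_denseSeq (Lp ℝ 1 μ)).exists_dist_lt hf.toL1 hε
  refine ⟨D j, hD j, ?_, ((tendsto_pi_nhds.1 hY) (i, j)).cauchySeq⟩
  rw [L1.dist_eq_integral_dist] at hj
  refine le_trans (le_of_eq (integral_congr_ae ?_)) hj.le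
  filter_upwards [hf.coeFn_toL1] with x hx
  rw [hx, Real.dist_eq]

end Diagonal

variable {d : ℕ} {C : ℝ}

/-- Lebesgue measure on the time slab `(0, T] × ℝ^d`. -/
noncomputable abbrev slab (d : ℕ) (T : ℝ) : Measure (ℝ × Space d) :=
  (volume.restrict (Ioc 0 T)).prod volume

theorem IsTest.integrable {F : Type*} [NormedAddCommGroup F] [NormedSpace ℝ F]
    [MeasurableSpace F] [OpensMeasurableSpace F] {μ : Measure F} [IsFiniteMeasureOnCompacts μ]
    {χ : F → ℝ} (hχ : IsTest χ) : Integrable χ μ :=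
  hχ.contDiff.continuous.integrable_of_hasCompactSupport hχ.hasCompactSupport

theorem exists_isTest_integral_abs_sub_le {F : Type*} [NormedAddCommGroup F] [NormedSpace ℝ F]
    [FiniteDimensional ℝ F] [MeasurableSpace F] [BorelSpace F] {μ : Measure F}
    [IsFiniteMeasureOnCompacts μ] {f : F → ℝ} (hf : Integrable f μ) {ε : ℝ} (hε : 0 < ε) :
    ∃ χ : F → ℝ, IsTest χ ∧ ∫ x, |f x - χ x| ∂μ ≤ ε := by
  obtain ⟨χ, h1, h2, h3⟩ := (memLp_one_iff_integrable.2 hf).exist_eLpNorm_sub_le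
    ENNReal.one_ne_top le_rfl hε
  have hχ : IsTest χ := ⟨h2, h1⟩
  refine ⟨χ, hχ, ?_⟩
  have h4 : eLpNorm (f - χ) 1 μ = ENNReal.ofReal (∫ x, |f x - χ x| ∂μ) := by
    rw [eLpNorm_one_eq_lintegral_enorm,
      ← ofReal_integral_norm_eq_lintegral_enorm (hf.sub hχ.integrable)]
    rfl
  rw [h4] at h3
  exact (ENNReal.ofReal_le_ofReal_iff hε.le).1 h3

theorem IsTest.slice {ψ : ℝ × Space d → ℝ} (hψ : IsTest ψ) (t : ℝ) :
    IsTest fun x => ψ (t, x) where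
  contDiff := hψ.contDiff.comp (by fun_prop)
  hasCompactSupport := HasCompactSupport.of_support_subset_isCompact
    (hψ.hasCompactSupport.isCompact.image continuous_snd)
    fun x hx => ⟨(t, x), subset_tsupport _ hx, rfl⟩

/-- A spatial test function, cut off in time outside `[-T, T]`. -/
theorem IsTest.exists_extension {χ : Space d → ℝ} (hχ : IsTest χ) (T : ℝ) :
    ∃ ψ : ℝ × Space d → ℝ, IsTest ψ ∧ ∀ t ∈ Icc (-T) T, ∀ x, ψ (t, x) = χ x := by
  let θ : ContDiffBump (0 : ℝ) := ⟨|T| + 1, |T| + 2, by positivity, by linarith⟩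
  refine ⟨fun z => θ z.1 * χ z.2, ⟨?_, ?_⟩, fun t ht x => ?_⟩
  · exact (θ.contDiff.comp contDiff_fst).mul (hχ.contDiff.comp contDiff_snd)
  · refine HasCompactSupport.of_support_subset_isCompact
      (θ.hasCompactSupport.isCompact.prod hχ.hasCompactSupport.isCompact) fun z hz => ?_
    exact ⟨subset_tsupport _ (left_ne_zero_of_mul hz), subset_tsupport _ (right_ne_zero_of_mul hz)⟩
  · have : θ t = 1 := θ.one_of_mem_closedBall (by
      rw [mem_closedBall_zero_iff, Real.norm_eq_abs]
      change |t| ≤ |T| + 1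
      have := abs_le.2 ht
      linarith [le_abs_self T])
    simp [this]

theorem integral_slab {f : ℝ × Space d → ℝ} {T : ℝ} (hT : 0 ≤ T) (hf : Integrable f (slab d T)) :
    ∫ z, f z ∂slab d T = ∫ u in (0 : ℝ)..T, ∫ x, f (u, x) := by
  rw [intervalIntegral.integral_of_le hT, integral_prod _ hf]

theorem intervalIntegrable_slab {f : ℝ × Space d → ℝ} {T : ℝ} (hT : 0 ≤ T)
    (hf : Integrable f (slab d T)) :
    IntervalIntegrable (fun u => ∫ x, f (u, x)) volume 0 T :=
  (intervalIntegrable_iff_integrableOn_Ioc_of_le hT).2 hf.integral_prod_left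

/-- The defect of `φ` in the weak formulation up to time `T` of a linear Cauchy problem with initial
datum `φ₀`.  Here `ψ` is the test function, and `h` is its image under the formal adjoint of the
evolution operator, time derivative included. -/
noncomputable def weakDefect (φ₀ : Space d → ℝ) (φ : ℝ → Space d → ℝ) (ψ h : ℝ × Space d → ℝ)
    (T : ℝ) : ℝ :=
  (∫ x, φ T x * ψ (T, x)) - (∫ x, φ₀ x * ψ (0, x)) - ∫ z, φ z.1 z.2 * h z ∂slab d T

/-- Differences of the values of an asymptotic solution against a fixed spatial test function are
controlled by the increments of a primitive and by the defects. -/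
theorem abs_integral_mul_sub_le_weakDefect {φ₀ : Space d → ℝ} {φ : ℝ → Space d → ℝ}
    (hφ : Measurable (uncurry φ)) (hφC : ∀ t x, |φ t x| ≤ C)
    {χ : Space d → ℝ} {ψ h : ℝ × Space d → ℝ} {T : ℝ} (hψ : ∀ t ∈ Icc (-T) T, ∀ x, ψ (t, x) = χ x)
    (hh : ∀ T, Integrable h (slab d T)) {s t : ℝ} (hs : 0 ≤ s) (hst : s ≤ t) (htT : t ≤ T) :
    |(∫ x, φ t x * χ x) - ∫ x, φ s x * χ x| ≤ C * (∫ u in s..t, ∫ x, |h (u, x)|)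
      + |weakDefect φ₀ φ ψ h t| + |weakDefect φ₀ φ ψ h s| := by
  have hφh : ∀ T, Integrable (fun z => φ z.1 z.2 * h z) (slab d T) := fun T =>
    integrable_bounded_mul (g := fun z => φ z.1 z.2) hφ.aestronglyMeasurable
      (fun z => hφC z.1 z.2) (hh T)
  have ht : 0 ≤ t := hs.trans hst
  have e1 : (∫ x, φ t x * χ x) - ∫ x, φ s x * χ x
      = weakDefect φ₀ φ ψ h t - weakDefect φ₀ φ ψ h s
        + ∫ u in s..t, ∫ x, φ u x * h (u, x) := by
    have e2 : ∫ u in s..t, ∫ x, φ u x * h (u, x) = (∫ z, φ z.1 z.2 * h z ∂slab d t)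
        - ∫ z, φ z.1 z.2 * h z ∂slab d s := by
      rw [integral_slab ht (hφh t), integral_slab hs (hφh s),
        intervalIntegral.integral_interval_sub_left (intervalIntegrable_slab ht (hφh t))
          (intervalIntegrable_slab hs (hφh s))]
    rw [e2]
    simp only [weakDefect]
    simp_rw [hψ t ⟨by linarith, htT⟩, hψ s ⟨by linarith, by linarith⟩]
    ring
  have e3 : |∫ u in s..t, ∫ x, φ u x * h (u, x)| ≤ C * ∫ u in s..t, ∫ x, |h (u, x)| := by
    rw [← intervalIntegral.integral_const_mul, ← Real.norm_eq_abs]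
    have hi : IntegrableOn (fun u => ∫ x, |h (u, x)|) (Ioc 0 t) :=
      (hh t).abs.integral_prod_left
    refine intervalIntegral.norm_integral_le_of_norm_le hst ?_ ?_
    · have h1 : ∀ᵐ u ∂(volume.restrict (Ioc 0 t)), Integrable (fun x => h (u, x)) :=
        (hh t).prod_right_ae
      rw [ae_restrict_iff' measurableSet_Ioc] at h1
      filter_upwards [h1] with u hu hu'
      exact abs_integral_mul_le (hφC u) (hu ⟨hs.trans_lt hu'.1, hu'.2⟩)
    · rw [intervalIntegrable_iff_integrableOn_Ioc_of_le hst]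
      exact (hi.mono_set (Ioc_subset_Ioc_left hs)).const_mul C
  rw [e1]
  have h1 := abs_add_le (weakDefect φ₀ φ ψ h t - weakDefect φ₀ φ ψ h s)
    (∫ u in s..t, ∫ x, φ u x * h (u, x))
  have h2 := abs_sub (weakDefect φ₀ φ ψ h t) (weakDefect φ₀ φ ψ h s)
  linarith

/-- Convergence at rational times propagates to all times by asymptotic equicontinuity. -/
theorem cauchySeq_integral_mul_of_weakDefect {φ₀ : Space d → ℝ} {φ : ℕ → ℝ → Space d → ℝ}
    (hφ : ∀ n, Measurable (uncurry (φ n))) (hC : 0 ≤ C) (hφC : ∀ n t x, |φ n t x| ≤ C)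
    {H : (ℝ × Space d → ℝ) → ℝ × Space d → ℝ}
    (hH : ∀ ψ, IsTest ψ → ∀ T, Integrable (H ψ) (slab d T))
    (hlim : ∀ ψ, IsTest ψ → ∀ T, 0 ≤ T →
      Tendsto (fun n => weakDefect φ₀ (φ n) ψ (H ψ) T) atTop (𝓝 0))
    (hrat : ∀ q : ℚ, ∀ f : Space d → ℝ, Integrable f → CauchySeq fun n => ∫ x, φ n q x * f x)
    {t : ℝ} (ht : 0 ≤ t) {f : Space d → ℝ} (hf : Integrable f) :
    CauchySeq fun n => ∫ x, φ n t x * f x := by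
  refine cauchySeq_integral_mul_of_approx (g := fun n => φ n t)
    (fun n => ((hφ n).comp measurable_prodMk_left).aestronglyMeasurable) hC
    (fun n => hφC n t) hf fun ε hε => ?_
  obtain ⟨χ, hχ, hfχ⟩ := exists_isTest_integral_abs_sub_le hf hε
  refine ⟨χ, hχ.integrable, hfχ, ?_⟩
  obtain ⟨ψ, hψ, hψχ⟩ := hχ.exists_extension (t + 1)
  have hcont : ContinuousOn (fun s => ∫ u in t..s, ∫ x, |H ψ (u, x)|) (Icc t (t + 1)) := by
    have hi : IntegrableOn (fun u => ∫ x, |H ψ (u, x)|) (Ioc 0 (t + 1)) :=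
      (hH ψ hψ (t + 1)).abs.integral_prod_left
    have := intervalIntegral.continuousOn_primitive_interval (μ := volume)
      (f := fun u => ∫ x, |H ψ (u, x)|) (a := t) (b := t + 1) (by
        rw [uIcc_of_le (by linarith), integrableOn_Icc_iff_integrableOn_Ioc]
        exact hi.mono_set (Ioc_subset_Ioc_left ht))
    rwa [uIcc_of_le (by linarith)] at this
  rw [Metric.cauchySeq_iff]
  intro η hη
  have hzero : Tendsto (fun s => C * ∫ u in t..s, ∫ x, |H ψ (u, x)|) (𝓝[Icc t (t + 1)] t)
      (𝓝 0) := by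
    have := (hcont t ⟨le_rfl, by linarith⟩).tendsto.const_mul C
    rwa [intervalIntegral.integral_same, mul_zero] at this
  have hev : ∀ᶠ s in 𝓝[>] t, C * ∫ u in t..s, ∫ x, |H ψ (u, x)| < η / 8 := by
    have : 𝓝[>] t ≤ 𝓝[Icc t (t + 1)] t :=
      nhdsWithin_le_iff.2 (mem_of_superset (Ioc_mem_nhdsGT (by linarith)) Ioc_subset_Icc_self)
    exact (hzero.mono_left this).eventually (gt_mem_nhds (by positivity))
  obtain ⟨b, hb, hsub⟩ := (mem_nhdsGT_iff_exists_Ioo_subset).1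
    (hev.and (Ioc_mem_nhdsGT (show t < t + 1 by linarith)))
  -- a rational time just after `t`, at which the integrals converge
  obtain ⟨q, hq1, hq2⟩ := exists_rat_btwn (show t < b from hb)
  obtain ⟨hq3, -, hq4⟩ := hsub ⟨hq1, hq2⟩
  have hd : ∀ s, 0 ≤ s → ∀ᶠ n in atTop, |weakDefect φ₀ (φ n) ψ (H ψ) s| < η / 8 := fun s hs => by
    have := (hlim ψ hψ s hs).abs
    rw [abs_zero] at this
    exact this.eventually (gt_mem_nhds (by positivity))
  obtain ⟨N₁, hN₁⟩ := eventually_atTop.1 ((hd t ht).and (hd q (ht.trans hq1.le)))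
  obtain ⟨N₂, hN₂⟩ := Metric.cauchySeq_iff.1 (hrat q χ hχ.integrable) (η / 4) (by positivity)
  have key : ∀ n ≥ N₁, |(∫ x, φ n q x * χ x) - ∫ x, φ n t x * χ x| < 3 * η / 8 := fun n hn => by
    have := abs_integral_mul_sub_le_weakDefect (φ₀ := φ₀) (hφ n) (hφC n) hψχ (hH ψ hψ) ht hq1.le hq4
    linarith [(hN₁ n hn).1, (hN₁ n hn).2]
  refine ⟨max N₁ N₂, fun m hm n hn => ?_⟩
  have h1 := key m (le_of_max_le_left hm)
  have h2 := key n (le_of_max_le_left hn)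
  have h3 := hN₂ m (le_of_max_le_right hm) n (le_of_max_le_right hn)
  rw [Real.dist_eq] at h3 ⊢
  rw [abs_lt] at *
  constructor <;> linarith [h1.1, h1.2, h2.1, h2.2, h3.1, h3.2]

/-- A sequence of bump functions concentrating at the origin.  The ratio of the outer to the inner
radius is kept fixed, as Lebesgue's differentiation theorem requires. -/
noncomputable def mollifier (E : Type*) [NormedAddCommGroup E] [NormedSpace ℝ E]
    [HasContDiffBump E] (m : ℕ) : ContDiffBump (0 : E) where
  rIn := 1 / (m + 1)
  rOut := 2 / (m + 1)
  rIn_pos := by positivity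
  rIn_lt_rOut := by gcongr; norm_num

theorem tendsto_mollifier_rOut (E : Type*) [NormedAddCommGroup E] [NormedSpace ℝ E]
    [HasContDiffBump E] : Tendsto (fun m => (mollifier E m).rOut) atTop (𝓝 0) := by
  have := (tendsto_one_div_add_atTop_nhds_zero_nat (𝕜 := ℝ)).const_mul 2
  rw [mul_zero] at this
  refine this.congr fun m => ?_
  simp [mollifier, div_eq_mul_inv]

/-- Weak limits at each nonnegative time have a jointly measurable representative: the limits of
the mollifications are limits of jointly measurable functions, and Lebesgue's differentiation
theorem identifies them almost everywhere at each time. -/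
theorem exists_measurable_tendsto_integral_mul {φ : ℕ → ℝ → Space d → ℝ}
    (hφ : ∀ n, Measurable (uncurry (φ n))) (hC : 0 ≤ C) (hφC : ∀ n t x, |φ n t x| ≤ C)
    (hcau : ∀ t, 0 ≤ t → ∀ f : Space d → ℝ, Integrable f →
      CauchySeq fun n => ∫ x, φ n t x * f x) :
    ∃ φ' : ℝ → Space d → ℝ, Measurable (uncurry φ') ∧ (∀ t x, |φ' t x| ≤ C) ∧
      ∀ t, 0 ≤ t → ∀ f : Space d → ℝ, Integrable f →
        Tendsto (fun n => ∫ x, φ n t x * f x) atTop (𝓝 (∫ x, φ' t x * f x)) := by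
  let ρ : ℕ → Space d → ℝ := fun m => (mollifier (Space d) m).normed volume
  have hρ : ∀ m, Continuous (ρ m) := fun m => (mollifier (Space d) m).continuous_normed
  have hρi : ∀ m, Integrable (ρ m) := fun m => (mollifier (Space d) m).integrable_normed
  let J : ℕ → ℕ → ℝ × Space d → ℝ := fun m n z => ∫ y, φ n z.1 y * ρ m (z.2 - y)
  have hJ : ∀ m n, Measurable (J m n) := fun m n => by
    refine StronglyMeasurable.measurable (StronglyMeasurable.integral_prod_right'
      (f := fun p : (ℝ × Space d) × Space d => φ n p.1.1 p.2 * ρ m (p.1.2 - p.2)) ?_)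
    refine Measurable.stronglyMeasurable (Measurable.mul ?_ ?_)
    · exact (hφ n).comp ((measurable_fst.comp measurable_fst).prodMk measurable_snd)
    · exact (hρ m).measurable.comp ((measurable_snd.comp measurable_fst).sub measurable_snd)
  let L : ℝ × Space d → ℝ := fun z => limsup (fun m => limsup (fun n => J m n z) atTop) atTop
  have hL : Measurable L := Measurable.limsup fun m => Measurable.limsup (hJ m)
  refine ⟨fun t x => max (-C) (min C (L (t, x))), measurable_const.max (measurable_const.min hL),
    fun t x => abs_le.2 ⟨le_max_left _ _, max_le (by linarith) (min_le_left _ _)⟩,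
    fun t ht f hf => ?_⟩
  obtain ⟨g, hg, hgC, hlim⟩ := exists_tendsto_integral_mul_of_cauchySeq (μ := volume)
    (g := fun n => φ n t) (fun n => (hφ n).comp measurable_prodMk_left) hC (fun n => hφC n t)
    (hcau t ht)
  have hgl : LocallyIntegrable g volume := by
    refine (locallyIntegrable_const C).mono hg.aestronglyMeasurable
      (Eventually.of_forall fun x => ?_)
    simpa [abs_of_nonneg hC] using hgC x
  have hae : ∀ᵐ x, max (-C) (min C (L (t, x))) = g x := by
    filter_upwards [ContDiffBump.ae_convolution_tendsto_right_of_locallyIntegrable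
      (φ := mollifier (Space d)) (l := atTop) (K := 2) (tendsto_mollifier_rOut _)
      (Eventually.of_forall fun m => by simp [mollifier, div_eq_mul_inv]) hgl] with x hx
    have h1 : ∀ m, limsup (fun n => J m n (t, x)) atTop
        = convolution (ρ m) g (ContinuousLinearMap.lsmul ℝ ℝ) volume x := fun m => by
      refine Tendsto.limsup_eq ?_
      have := hlim (fun y => ρ m (x - y)) ((hρi m).comp_sub_left x)
      rw [convolution_eq_swap]
      simpa [J, mul_comm] using this
    have h2 : L (t, x) = g x := by
      simp only [L, h1]
      exact hx.limsup_eq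
    rw [h2, min_eq_right (abs_le.1 (hgC x)).2, max_eq_right (abs_le.1 (hgC x)).1]
  have : ∫ x, max (-C) (min C (L (t, x))) * f x = ∫ x, g x * f x :=
    integral_congr_ae (hae.mono fun x hx => by simp only [hx])
  rw [this]
  exact hlim f hf

/-- Compactness: a bounded sequence of asymptotic solutions, whose defects tend to zero at each
time, produces an exact solution. -/
theorem exists_weakDefect_eq_zero {φ₀ : Space d → ℝ} {φ : ℕ → ℝ → Space d → ℝ}
    (hφ : ∀ n, Measurable (uncurry (φ n))) (hC : 0 ≤ C) (hφC : ∀ n t x, |φ n t x| ≤ C)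
    {H : (ℝ × Space d → ℝ) → ℝ × Space d → ℝ}
    (hH : ∀ ψ, IsTest ψ → ∀ T, Integrable (H ψ) (slab d T))
    (hlim : ∀ ψ, IsTest ψ → ∀ T, 0 ≤ T →
      Tendsto (fun n => weakDefect φ₀ (φ n) ψ (H ψ) T) atTop (𝓝 0)) :
    ∃ φ' : ℝ → Space d → ℝ, Measurable (uncurry φ') ∧ (∀ t x, |φ' t x| ≤ C) ∧
      ∀ ψ, IsTest ψ → ∀ T, 0 ≤ T → weakDefect φ₀ φ' ψ (H ψ) T = 0 := by
  obtain ⟨k, hk, hrat⟩ := exists_subseq_forall_cauchySeq (μ := (volume : Measure (Space d)))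
    (g := fun n (q : ℚ) => φ n q) (fun n q => (hφ n).comp measurable_prodMk_left) hC
    (fun n q => hφC n q)
  obtain ⟨φ', hφ', hφC', hconv⟩ := exists_measurable_tendsto_integral_mul
    (φ := fun n => φ (k n)) (fun n => hφ (k n)) hC (fun n => hφC (k n))
    (fun t ht f hf => cauchySeq_integral_mul_of_weakDefect (φ := fun n => φ (k n))
      (fun n => hφ (k n)) hC (fun n => hφC (k n)) hH
      (fun ψ hψ T hT => (hlim ψ hψ T hT).comp hk.tendsto_atTop) hrat ht hf)
  refine ⟨φ', hφ', hφC', fun ψ hψ T hT => ?_⟩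
  refine tendsto_nhds_unique ?_ ((hlim ψ hψ T hT).comp hk.tendsto_atTop)
  have hHT := hH ψ hψ T
  have hint : ∀ g : ℝ → Space d → ℝ, Measurable (uncurry g) → (∀ t x, |g t x| ≤ C) →
      Integrable (fun z => g z.1 z.2 * H ψ z) (slab d T) := fun g hg hgC =>
    integrable_bounded_mul (g := fun z => g z.1 z.2) hg.aestronglyMeasurable
      (fun z => hgC z.1 z.2) hHT
  refine ((hconv T hT _ (hψ.slice T).integrable).sub tendsto_const_nhds).sub ?_
  rw [integral_prod _ (hint φ' hφ' hφC')]
  simp_rw [fun n => integral_prod _ (hint (φ (k n)) (hφ (k n)) (hφC (k n)))]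
  refine tendsto_integral_of_dominated_convergence (fun u => C * ∫ x, |H ψ (u, x)|)
    (fun n => (hint _ (hφ (k n)) (hφC (k n))).integral_prod_left.1)
    (hHT.abs.integral_prod_left.const_mul C) (fun n => ?_) ?_
  · filter_upwards [hHT.prod_right_ae] with u hu
    exact abs_integral_mul_le (hφC (k n) u) hu
  · filter_upwards [hHT.prod_right_ae, ae_restrict_mem measurableSet_Ioc] with u hu hu'
    exact hconv u hu'.1.le _ hu

/-! ### Difference quotients -/

section DifferenceQuotients

variable {F : Type*} [NormedAddCommGroup F] [NormedSpace ℝ F] {f : F → ℝ}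

theorem IsTest.fderiv_apply (hf : IsTest f) (w : F) : IsTest fun z => fderiv ℝ f z w where
  contDiff := (hf.contDiff.fderiv_right (m := ∞) (by simp)).clm_apply contDiff_const
  hasCompactSupport := (hf.hasCompactSupport.fderiv ℝ).comp_left
    (g := fun A : F →L[ℝ] ℝ => A w) (by simp)

theorem IsTest.contDiff_two (hf : IsTest f) : ContDiff ℝ 2 f :=
  mod_cast contDiff_infty.1 hf.contDiff 2

theorem IsTest.contDiff_one (hf : IsTest f) : ContDiff ℝ 1 f :=
  mod_cast contDiff_infty.1 hf.contDiff 1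

theorem IsTest.exists_bound (hf : IsTest f) : ∃ B, 0 < B ∧ ∀ z, |f z| ≤ B := by
  obtain ⟨B, hB⟩ := hf.hasCompactSupport.exists_bound_of_continuous hf.contDiff.continuous
  exact ⟨|B| + 1, by positivity, fun z => by
    have := hB z
    rw [Real.norm_eq_abs] at this
    linarith [le_abs_self B]⟩

theorem exists_sub_eq_fderiv (hf : Differentiable ℝ f) (z w : F) :
    ∃ s ∈ Icc (0 : ℝ) 1, f (z + w) - f z = fderiv ℝ f (z + s • w) w := by
  obtain ⟨y, hy, h⟩ := domain_mvt (f := f) (s := univ) (x := z) (y := z + w)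
    (fun x _ => (hf x).hasFDerivAt.hasFDerivWithinAt) convex_univ (mem_univ _) (mem_univ _)
  rw [segment_eq_image'] at hy
  obtain ⟨s, hs, rfl⟩ := hy
  exact ⟨s, hs, by simpa using h⟩

theorem exists_secondDifference_eq (hf : ContDiff ℝ 2 f) (z w : F) (ε : ℝ) :
    ∃ s ∈ Icc (-1 : ℝ) 1, f (z + ε • w) + f (z - ε • w) - 2 * f z
      = ε ^ 2 * fderiv ℝ (fun y => fderiv ℝ f y w) (z + (s * ε) • w) w := by
  have hfd : Differentiable ℝ f := hf.differentiable (by norm_num)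
  have hf' : Differentiable ℝ fun y => fderiv ℝ f y w :=
    ((hf.fderiv_right (m := 1) (by norm_num)).clm_apply contDiff_const).differentiable (by norm_num)
  have hfs : Differentiable ℝ fun y => f (y + ε • w) := hfd.comp (by fun_prop)
  have hg : Differentiable ℝ fun y => f (y + ε • w) - f y := hfs.sub hfd
  obtain ⟨s, hs, h1⟩ := exists_sub_eq_fderiv hg (z - ε • w) (ε • w)
  obtain ⟨r, hr, h2⟩ := exists_sub_eq_fderiv hf' (z - ε • w + s • ε • w) (ε • w)
  refine ⟨s + r - 1, ⟨by linarith [hs.1, hr.1], by linarith [hs.2, hr.2]⟩, ?_⟩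
  have h3 : ∀ y, fderiv ℝ (fun y => f (y + ε • w) - f y) y
      = fderiv ℝ f (y + ε • w) - fderiv ℝ f y := fun y => by
    rw [fderiv_fun_sub (hfs y) (hfd y), fderiv_comp_add_right]
  rw [h3] at h1
  simp only [map_smul, _root_.sub_apply, smul_eq_mul, sub_add_cancel] at h1 h2
  have h4 : z - ε • w + s • ε • w + r • ε • w = z + ((s + r - 1) * ε) • w := by
    module
  rw [h4] at h2
  rw [h2] at h1
  linear_combination h1

theorem tendsto_differenceQuotient (hf : ContDiff ℝ 1 f) {z : ℕ → F} {z₀ w : F} {ε : ℕ → ℝ}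
    (hz : Tendsto z atTop (𝓝 z₀)) (hε : Tendsto ε atTop (𝓝 0)) (hε0 : ∀ n, ε n ≠ 0) :
    Tendsto (fun n => (f (z n + ε n • w) - f (z n)) / ε n) atTop (𝓝 (fderiv ℝ f z₀ w)) := by
  choose s hs h using fun n =>
    exists_sub_eq_fderiv (hf.differentiable (by norm_num)) (z n) (ε n • w)
  have h1 : ∀ n, (f (z n + ε n • w) - f (z n)) / ε n = fderiv ℝ f (z n + (s n * ε n) • w) w :=
    fun n => by
      rw [h n, map_smul, smul_eq_mul, mul_div_cancel_left₀ _ (hε0 n), smul_smul]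
  simp_rw [h1]
  have h2 : Tendsto (fun n => s n * ε n) atTop (𝓝 0) :=
    squeeze_zero_norm (a := fun n => ‖ε n‖) (fun n => by
      rw [norm_mul, Real.norm_eq_abs (s n), abs_of_nonneg (hs n).1]
      exact mul_le_of_le_one_left (norm_nonneg _) (hs n).2) (by simpa using hε.norm)
  have h3 : Tendsto (fun n => z n + (s n * ε n) • w) atTop (𝓝 z₀) := by
    simpa using hz.add (h2.smul_const w)
  exact (((hf.continuous_fderiv (by norm_num)).clm_apply continuous_const).tendsto z₀).comp h3

theorem abs_differenceQuotient_le (hf : Differentiable ℝ f) {w : F} {B : ℝ}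
    (hB : ∀ z, |fderiv ℝ f z w| ≤ B) (z : F) {ε : ℝ} (hε : ε ≠ 0) :
    |(f (z + ε • w) - f z) / ε| ≤ B := by
  obtain ⟨s, -, h⟩ := exists_sub_eq_fderiv hf z (ε • w)
  rw [h, map_smul, smul_eq_mul, mul_div_cancel_left₀ _ hε]
  exact hB _

theorem tendsto_secondDifferenceQuotient (hf : ContDiff ℝ 2 f) {z : ℕ → F} {z₀ w : F} {ε : ℕ → ℝ}
    (hz : Tendsto z atTop (𝓝 z₀)) (hε : Tendsto ε atTop (𝓝 0)) (hε0 : ∀ n, ε n ≠ 0) :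
    Tendsto (fun n => (f (z n + ε n • w) + f (z n - ε n • w) - 2 * f (z n)) / ε n ^ 2) atTop
      (𝓝 (fderiv ℝ (fun y => fderiv ℝ f y w) z₀ w)) := by
  choose s hs h using fun n => exists_secondDifference_eq hf (z n) w (ε n)
  have h1 : ∀ n, (f (z n + ε n • w) + f (z n - ε n • w) - 2 * f (z n)) / ε n ^ 2
      = fderiv ℝ (fun y => fderiv ℝ f y w) (z n + (s n * ε n) • w) w :=
    fun n => by rw [h n, mul_div_cancel_left₀ _ (pow_ne_zero 2 (hε0 n))]
  simp_rw [h1]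
  have h2 : Tendsto (fun n => s n * ε n) atTop (𝓝 0) :=
    squeeze_zero_norm (a := fun n => ‖ε n‖) (fun n => by
      rw [norm_mul, Real.norm_eq_abs (s n)]
      exact mul_le_of_le_one_left (norm_nonneg _) (abs_le.2 (hs n))) (by simpa using hε.norm)
  have h3 : Tendsto (fun n => z n + (s n * ε n) • w) atTop (𝓝 z₀) := by
    simpa using hz.add (h2.smul_const w)
  have hf' : ContDiff ℝ 1 fun y => fderiv ℝ f y w :=
    (hf.fderiv_right (m := 1) (by norm_num)).clm_apply contDiff_const
  exact (((hf'.continuous_fderiv (by norm_num)).clm_apply continuous_const).tendsto z₀).comp h3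

theorem abs_secondDifferenceQuotient_le (hf : ContDiff ℝ 2 f) {w : F} {B : ℝ}
    (hB : ∀ z, |fderiv ℝ (fun y => fderiv ℝ f y w) z w| ≤ B) (z : F) {ε : ℝ} (hε : ε ≠ 0) :
    |(f (z + ε • w) + f (z - ε • w) - 2 * f z) / ε ^ 2| ≤ B := by
  obtain ⟨s, -, h⟩ := exists_secondDifference_eq hf z w ε
  rw [h, mul_div_cancel_left₀ _ (pow_ne_zero 2 hε)]
  exact hB _

end DifferenceQuotients

/-! ### An explicit monotone scheme for smooth vector fields -/

section Scheme

variable {d : ℕ} {C : ℝ}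

/-- The `i`-th unit vector of `ℝ^d`. -/
noncomputable abbrev unit (i : Fin d) : Space d := EuclideanSpace.single i 1

/-- The `i`-th spatial unit vector of `ℝ × ℝ^d`. -/
noncomputable abbrev stUnit (i : Fin d) : ℝ × Space d := (0, unit i)

/-- The formal adjoint `∂ₜψ - ∇·(ψ V) + ν Δψ` of the evolution operator
`φ ↦ - ∂ₜφ + V·∇φ + ν Δφ`, for a vector field `V` given by its components. -/
noncomputable def adjointOp (ν : ℝ) (V : Fin d → ℝ × Space d → ℝ) (ψ : ℝ × Space d → ℝ)
    (z : ℝ × Space d) : ℝ :=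
  fderiv ℝ ψ z (1, 0)
    - ∑ i, (fderiv ℝ (V i) z (stUnit i) * ψ z + V i z * fderiv ℝ ψ z (stUnit i))
    + ν * ∑ i, fderiv ℝ (fun y => fderiv ℝ ψ y (stUnit i)) z (stUnit i)

/-- An explicit scheme for `∂ₜφ = V·∇φ + ν Δφ` with space step `ε` and time step `τ`: when
`c * |V i| ≤ 1 / (2 * d)`, each value is an average of values at the previous time. -/
noncomputable def scheme (V : Fin d → ℝ × Space d → ℝ) (φ₀ : Space d → ℝ) (c ε τ : ℝ) :
    ℕ → Space d → ℝ
  | 0 => φ₀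
  | k + 1 => fun x => ∑ i,
      ((1 / (2 * d) + c * V i (k * τ, x)) * scheme V φ₀ c ε τ k (x + ε • unit i)
        + (1 / (2 * d) - c * V i (k * τ, x)) * scheme V φ₀ c ε τ k (x - ε • unit i))

/-- The finite difference analogue of `adjointOp`, with viscosity `κ`, dual to the step of `scheme`
from time `k * τ` to time `(k + 1) * τ`: the field is sampled at the former and the test function
at the latter. -/
noncomputable def discreteAdjoint (V : Fin d → ℝ × Space d → ℝ) (κ ε τ : ℝ)
    (ψ : ℝ × Space d → ℝ) (k : ℕ) (x : Space d) : ℝ :=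
  (ψ ((k + 1) * τ, x) - ψ (k * τ, x)) / τ
    - ∑ i, (V i (k * τ, x + ε • unit i) * ψ ((k + 1) * τ, x + ε • unit i)
        - V i (k * τ, x - ε • unit i) * ψ ((k + 1) * τ, x - ε • unit i)) / (2 * ε)
    + κ * ∑ i, (ψ ((k + 1) * τ, x + ε • unit i) + ψ ((k + 1) * τ, x - ε • unit i)
        - 2 * ψ ((k + 1) * τ, x)) / ε ^ 2

variable {V : Fin d → ℝ × Space d → ℝ} {φ₀ : Space d → ℝ} {c ε τ κ : ℝ}

theorem continuous_scheme (hV : ∀ i, Continuous (V i)) (hφ₀ : Continuous φ₀) (k : ℕ) :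
    Continuous (scheme V φ₀ c ε τ k) := by
  induction k with
  | zero => exact hφ₀
  | succ k ih =>
    simp only [scheme]
    fun_prop

theorem abs_scheme_le (hd : 1 ≤ d) (hcV : ∀ i z, |c * V i z| ≤ 1 / (2 * d))
    (hφ₀ : ∀ x, |φ₀ x| ≤ C) (k : ℕ) (x : Space d) : |scheme V φ₀ c ε τ k x| ≤ C := by
  induction k generalizing x with
  | zero => exact hφ₀ x
  | succ k ih =>
    simp only [scheme]
    have hd0 : (d : ℝ) ≠ 0 := by positivity
    calc _ ≤ ∑ i : Fin d, (1 / d : ℝ) * C := by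
          refine (Finset.abs_sum_le_sum_abs _ _).trans (Finset.sum_le_sum fun i _ => ?_)
          have h := abs_le.1 (hcV i (k * τ, x))
          have h1 := ih (x + ε • unit i)
          have h2 := ih (x - ε • unit i)
          refine (abs_add_le _ _).trans ?_
          rw [abs_mul, abs_mul, abs_of_nonneg (a := 1 / (2 * (d : ℝ)) + _) (by linarith [h.1]),
            abs_of_nonneg (a := 1 / (2 * (d : ℝ)) - _) (by linarith [h.2])]
          have e : (1 / d : ℝ) = 1 / (2 * d) + 1 / (2 * d) := by field_simp; norm_num
          rw [e]
          have := mul_le_mul_of_nonneg_left h1 (a := 1 / (2 * (d : ℝ)) + c * V i (k * τ, x))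
            (by linarith [h.1])
          have := mul_le_mul_of_nonneg_left h2 (a := 1 / (2 * (d : ℝ)) - c * V i (k * τ, x))
            (by linarith [h.2])
          linarith
      _ = C := by
          rw [Finset.sum_const, Finset.card_univ, Fintype.card_fin, nsmul_eq_mul]
          field_simp

/-- Since translations preserve Lebesgue measure, the scheme can be integrated by parts exactly. -/
theorem integral_scheme_succ_mul (hV : ∀ i, Continuous (V i)) (hφ₀ : Continuous φ₀) (k : ℕ)
    {χ : Space d → ℝ} (hχ : Continuous χ) (hχs : HasCompactSupport χ) :
    ∫ x, scheme V φ₀ c ε τ (k + 1) x * χ x = ∫ x, scheme V φ₀ c ε τ k x *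
      ∑ i, (1 / (2 * d) * (χ (x + ε • unit i) + χ (x - ε • unit i))
        - c * (V i (k * τ, x + ε • unit i) * χ (x + ε • unit i)
          - V i (k * τ, x - ε • unit i) * χ (x - ε • unit i))) := by
  set Φ := scheme V φ₀ c ε τ k with hΦ
  have hΦc : Continuous Φ := continuous_scheme hV hφ₀ k
  let P : Fin d → Space d → ℝ := fun i x => (1 / (2 * d) + c * V i (k * τ, x)) * χ x
  let Q : Fin d → Space d → ℝ := fun i x => (1 / (2 * d) - c * V i (k * τ, x)) * χ x
  have hP : ∀ i, Continuous (P i) := fun i => by have := hV i; fun_prop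
  have hQ : ∀ i, Continuous (Q i) := fun i => by have := hV i; fun_prop
  have hPs : ∀ i, HasCompactSupport (P i) := fun i => hχs.mul_left
  have hQs : ∀ i, HasCompactSupport (Q i) := fun i => hχs.mul_left
  have shift : ∀ R : Space d → ℝ, HasCompactSupport R → ∀ a : Space d,
      HasCompactSupport fun x => R (x + a) := fun R hR a =>
    hR.comp_homeomorph (Homeomorph.addRight a)
  have i1 : ∀ i, Integrable fun x => Φ (x + ε • unit i) * P i x := fun i =>
    Continuous.integrable_of_hasCompactSupport (by have := hP i; fun_prop) (hPs i).mul_left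
  have i2 : ∀ i, Integrable fun x => Φ (x - ε • unit i) * Q i x := fun i =>
    Continuous.integrable_of_hasCompactSupport (by have := hQ i; fun_prop) (hQs i).mul_left
  have i3 : ∀ i, Integrable fun x => Φ x * P i (x - ε • unit i) := fun i =>
    Continuous.integrable_of_hasCompactSupport (by have := hP i; fun_prop)
      (by
        have h : HasCompactSupport fun x => P i (x - ε • unit i) := by
          simpa only [sub_eq_add_neg] using shift _ (hPs i) _
        exact h.mul_left)
  have i4 : ∀ i, Integrable fun x => Φ x * Q i (x + ε • unit i) := fun i =>
    Continuous.integrable_of_hasCompactSupport (by have := hQ i; fun_prop)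
      (shift _ (hQs i) _).mul_left
  have e1 : ∀ i, ∫ x, Φ (x + ε • unit i) * P i x = ∫ x, Φ x * P i (x - ε • unit i) := fun i => by
    rw [← integral_add_right_eq_self (fun x => Φ x * P i (x - ε • unit i)) (ε • unit i)]
    simp
  have e2 : ∀ i, ∫ x, Φ (x - ε • unit i) * Q i x = ∫ x, Φ x * Q i (x + ε • unit i) := fun i => by
    rw [← integral_sub_right_eq_self (fun x => Φ x * Q i (x + ε • unit i)) (ε • unit i)]
    simp
  calc ∫ x, scheme V φ₀ c ε τ (k + 1) x * χ x
      = ∫ x, ∑ i, (Φ (x + ε • unit i) * P i x + Φ (x - ε • unit i) * Q i x) := by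
        refine integral_congr_ae (Eventually.of_forall fun x => ?_)
        simp only [scheme, ← hΦ, Finset.sum_mul, P, Q]
        exact Finset.sum_congr rfl fun i _ => by ring
    _ = ∑ i, ((∫ x, Φ x * P i (x - ε • unit i)) + ∫ x, Φ x * Q i (x + ε • unit i)) := by
        rw [integral_finsetSum _ fun i _ => by exact (i1 i).add (i2 i)]
        refine Finset.sum_congr rfl fun i _ => ?_
        rw [integral_add (i1 i) (i2 i), e1, e2]
    _ = ∫ x, ∑ i, (Φ x * P i (x - ε • unit i) + Φ x * Q i (x + ε • unit i)) := by
        rw [integral_finsetSum _ fun i _ => by exact (i3 i).add (i4 i)]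
        exact Finset.sum_congr rfl fun i _ => (integral_add (i3 i) (i4 i)).symm
    _ = _ := by
        refine integral_congr_ae (Eventually.of_forall fun x => ?_)
        simp only [Finset.mul_sum, P, Q]
        exact Finset.sum_congr rfl fun i _ => by ring

theorem discreteAdjoint_eq_zero_of_norm_lt {ψ : ℝ × Space d → ℝ} {R : ℝ}
    (hR : ∀ t x, R < ‖x‖ → ψ (t, x) = 0) (hε : |ε| ≤ 1) (k : ℕ) {x : Space d} (hx : R + 1 < ‖x‖) :
    discreteAdjoint V κ ε τ ψ k x = 0 := by
  have hu : ∀ i : Fin d, ‖ε • unit i‖ ≤ 1 := fun i => by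
    rw [norm_smul, PiLp.norm_single, norm_one, mul_one]; exact hε
  have h0 : ∀ t, ψ (t, x) = 0 := fun t => hR t x (by linarith)
  have h1 : ∀ t i, ψ (t, x + ε • unit i) = 0 := fun t i => hR t _ (by
    have := norm_sub_norm_le x (-(ε • unit i))
    rw [norm_neg, sub_neg_eq_add] at this
    linarith [hu i])
  have h2 : ∀ t i, ψ (t, x - ε • unit i) = 0 := fun t i => hR t _ (by
    have := norm_sub_norm_le x (ε • unit i)
    linarith [hu i])
  simp [discreteAdjoint, h0, h1, h2]

theorem continuous_discreteAdjoint (hV : ∀ i, Continuous (V i)) {ψ : ℝ × Space d → ℝ}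
    (hψ : Continuous ψ) (k : ℕ) : Continuous (discreteAdjoint V κ ε τ ψ k) := by
  unfold discreteAdjoint
  fun_prop

/-- One step of the discrete weak formulation. -/
theorem integral_scheme_step (hd : 1 ≤ d) (hτ : 0 < τ)
    (hc : c = τ / (2 * ε)) (hκ : τ * κ / ε ^ 2 = 1 / (2 * d))
    (hV : ∀ i, Continuous (V i)) (hφ₀ : Continuous φ₀) {ψ : ℝ × Space d → ℝ} (hψ : IsTest ψ)
    (k : ℕ) :
    (∫ x, scheme V φ₀ c ε τ (k + 1) x * ψ ((k + 1) * τ, x))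
      - ∫ x, scheme V φ₀ c ε τ k x * ψ (k * τ, x)
      = τ * ∫ x, scheme V φ₀ c ε τ k x * discreteAdjoint V κ ε τ ψ k x := by
  have hψc := hψ.contDiff.continuous
  have hΦc : Continuous (scheme V φ₀ c ε τ k) := continuous_scheme hV hφ₀ k
  have hs := (hψ.slice ((k + 1) * τ))
  have shift : ∀ a : Space d, HasCompactSupport fun x => ψ ((k + 1) * τ, x + a) := fun a =>
    hs.hasCompactSupport.comp_homeomorph (Homeomorph.addRight a)
  rw [integral_scheme_succ_mul hV hφ₀ k hs.contDiff.continuous hs.hasCompactSupport,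
    ← integral_sub, ← integral_const_mul]
  · refine integral_congr_ae (Eventually.of_forall fun x => ?_)
    have hd0 : (d : ℝ) ≠ 0 := by positivity
    have e : ψ ((k + 1) * τ, x) = ∑ i : Fin d, 1 / (2 * (d : ℝ)) * (2 * ψ ((k + 1) * τ, x)) := by
      rw [Finset.sum_const, Finset.card_univ, Fintype.card_fin, nsmul_eq_mul]
      field_simp
    have key : (∑ i, (1 / (2 * (d : ℝ)) * (ψ ((k + 1) * τ, x + ε • unit i)
          + ψ ((k + 1) * τ, x - ε • unit i))
        - c * (V i (k * τ, x + ε • unit i) * ψ ((k + 1) * τ, x + ε • unit i)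
          - V i (k * τ, x - ε • unit i) * ψ ((k + 1) * τ, x - ε • unit i)))) - ψ (k * τ, x)
        = τ * discreteAdjoint V κ ε τ ψ k x := by
      have e1 : τ * discreteAdjoint V κ ε τ ψ k x = (ψ ((k + 1) * τ, x) - ψ (k * τ, x))
          - ∑ i, c * (V i (k * τ, x + ε • unit i) * ψ ((k + 1) * τ, x + ε • unit i)
            - V i (k * τ, x - ε • unit i) * ψ ((k + 1) * τ, x - ε • unit i))
          + ∑ i, 1 / (2 * (d : ℝ)) * (ψ ((k + 1) * τ, x + ε • unit i)
            + ψ ((k + 1) * τ, x - ε • unit i) - 2 * ψ ((k + 1) * τ, x)) := by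
        rw [discreteAdjoint, mul_add, mul_sub, ← mul_assoc τ κ, Finset.mul_sum, Finset.mul_sum,
          mul_div_cancel₀ _ hτ.ne', hc, ← hκ]
        congr 1
        · congr 1
          exact Finset.sum_congr rfl fun i _ => by ring
        · exact Finset.sum_congr rfl fun i _ => by ring
      rw [e1]
      simp only [mul_sub (1 / (2 * (d : ℝ))), Finset.sum_sub_distrib, ← e]
      ring
    beta_reduce
    rw [← mul_sub, key]
    ring
  · refine Continuous.integrable_of_hasCompactSupport (by fun_prop) ?_
    refine HasCompactSupport.mul_left ?_
    refine HasCompactSupport.of_support_subset_isCompact (K := ⋃ i : Fin d,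
      (tsupport (fun x => ψ ((k + 1) * τ, x + ε • unit i))
        ∪ tsupport (fun x => ψ ((k + 1) * τ, x + -(ε • unit i)))))
      (isCompact_iUnion fun i => (shift _).isCompact.union (shift _).isCompact) fun x hx => ?_
    obtain ⟨i, -, hi⟩ := Finset.exists_ne_zero_of_sum_ne_zero hx
    rw [mem_iUnion]
    refine ⟨i, ?_⟩
    by_contra hcon
    rw [mem_union, not_or] at hcon
    have h1 := image_eq_zero_of_notMem_tsupport hcon.1
    have h2 := image_eq_zero_of_notMem_tsupport hcon.2
    rw [← sub_eq_add_neg] at h2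
    rw [h1, h2] at hi
    simp at hi
  · have := (hψ.slice (k * τ))
    exact Continuous.integrable_of_hasCompactSupport (by fun_prop)
      this.hasCompactSupport.mul_left

theorem integral_floor_div (hτ : 0 < τ) (u : ℕ → ℝ) (N : ℕ) :
    IntervalIntegrable (fun t => u ⌊t / τ⌋₊) volume 0 (N * τ) ∧
      ∫ t in (0 : ℝ)..(N * τ), u ⌊t / τ⌋₊ = τ * ∑ k ∈ Finset.range N, u k := by
  have hfloor : ∀ k : ℕ, ∀ t ∈ Ico (k * τ) ((k + 1) * τ), u ⌊t / τ⌋₊ = u k := by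
    intro k t ht
    rw [(Nat.floor_eq_iff (div_nonneg (le_trans (by positivity) ht.1) hτ.le)).2
      ⟨(le_div_iff₀ hτ).2 ht.1, (div_lt_iff₀ hτ).2 ht.2⟩]
  have hle : ∀ k : ℕ, (k : ℝ) * τ ≤ (k + 1) * τ := fun k => by nlinarith
  induction N with
  | zero => simp
  | succ k ih =>
    have h1 : IntervalIntegrable (fun t => u ⌊t / τ⌋₊) volume (k * τ) ((k + 1) * τ) := by
      rw [intervalIntegrable_iff_integrableOn_Ico_of_le (hle k)]
      exact (integrableOn_const (by simp) (by simp) : IntegrableOn (fun _ => u k) _ _).congr_fun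
        (fun t ht => (hfloor k t ht).symm) measurableSet_Ico
    have h2 : ∫ t in (k * τ)..((k + 1) * τ), u ⌊t / τ⌋₊ = τ * u k := by
      rw [intervalIntegral.integral_of_le (hle k), ← integral_Ico_eq_integral_Ioc,
        setIntegral_congr_fun measurableSet_Ico (hfloor k), setIntegral_const]
      simp only [measureReal_def, Real.volume_Ico, smul_eq_mul]
      rw [ENNReal.toReal_ofReal (by linarith [hle k])]
      ring
    push_cast
    refine ⟨ih.1.trans h1, ?_⟩
    rw [← intervalIntegral.integral_add_adjacent_intervals ih.1 h1, ih.2, h2,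
      Finset.sum_range_succ, mul_add]

theorem measurable_floor_div {F : ℕ → Space d → ℝ} (hF : ∀ k, Measurable (F k)) (τ : ℝ) :
    Measurable fun z : ℝ × Space d => F ⌊z.1 / τ⌋₊ z.2 := by
  have h : Measurable (uncurry F) := measurable_from_prod_countable_right hF
  exact h.comp ((Nat.measurable_floor.comp (measurable_fst.div_const τ)).prodMk measurable_snd)

end Scheme

/-! ### Consistency of the scheme and smooth vector fields -/

section SmoothField

variable {d : ℕ} {C : ℝ} {V : Fin d → ℝ × Space d → ℝ} {φ₀ : Space d → ℝ} {c ε τ κ : ℝ}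

/-- `discreteAdjoint` in terms of difference quotients on `ℝ × ℝ^d`. -/
theorem discreteAdjoint_eq (ψ : ℝ × Space d → ℝ) (k : ℕ) (x : Space d) {a b : ℝ × Space d}
    (ha : a = (k * τ, x)) (hb : b = a + τ • (1, 0)) :
    discreteAdjoint V κ ε τ ψ k x = (ψ (a + τ • (1, 0)) - ψ a) / τ
      - ∑ i, ((V i (a - ε • stUnit i + (2 * ε) • stUnit i) - V i (a - ε • stUnit i)) / (2 * ε)
            * ψ (b + ε • stUnit i)
          + V i (a - ε • stUnit i)
            * ((ψ (b - ε • stUnit i + (2 * ε) • stUnit i) - ψ (b - ε • stUnit i)) / (2 * ε)))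
      + κ * ∑ i, (ψ (b + ε • stUnit i) + ψ (b - ε • stUnit i) - 2 * ψ b) / ε ^ 2 := by
  have e : ∀ (p : ℝ × Space d) (i : Fin d),
      p - ε • stUnit i + (2 * ε) • stUnit i = p + ε • stUnit i := fun p i => by module
  have hb' : b = ((k + 1) * τ, x) := by
    rw [hb, ha]
    ext1
    · simp; ring
    · simp
  have e1 : ∀ (t : ℝ) (i : Fin d), ((t, x) : ℝ × Space d) + ε • stUnit i = (t, x + ε • unit i) :=
    fun t i => by ext1 <;> simp
  have e2 : ∀ (t : ℝ) (i : Fin d), ((t, x) : ℝ × Space d) - ε • stUnit i = (t, x - ε • unit i) :=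
    fun t i => by ext1 <;> simp
  simp_rw [e, ← hb]
  rw [hb', ha]
  simp_rw [e1, e2]
  rw [discreteAdjoint]
  congr 2
  exact Finset.sum_congr rfl fun i _ => by ring

theorem abs_discreteAdjoint_le (hε : 0 < ε) (hτ : 0 < τ) (hV : ∀ i, ContDiff ℝ 1 (V i))
    {ψ : ℝ × Space d → ℝ} (hψ : ContDiff ℝ 2 ψ) {B₀ B₁ K : ℝ} {B₂ B₃ B₄ B₅ : Fin d → ℝ}
    (h₀ : ∀ z, |ψ z| ≤ B₀) (h₁ : ∀ z, |fderiv ℝ ψ z (1, 0)| ≤ B₁)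
    (h₂ : ∀ i z, |V i z| ≤ B₂ i) (h₃ : ∀ i z, |fderiv ℝ (V i) z (stUnit i)| ≤ B₃ i)
    (h₄ : ∀ i z, |fderiv ℝ ψ z (stUnit i)| ≤ B₄ i)
    (h₅ : ∀ i z, |fderiv ℝ (fun y => fderiv ℝ ψ y (stUnit i)) z (stUnit i)| ≤ B₅ i)
    (hκ : |κ| ≤ K) (k : ℕ) (x : Space d) :
    |discreteAdjoint V κ ε τ ψ k x|
      ≤ B₁ + ∑ i, (B₃ i * B₀ + B₂ i * B₄ i) + K * ∑ i, B₅ i := by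
  have hψd : Differentiable ℝ ψ := hψ.differentiable (by norm_num)
  have h2ε : 2 * ε ≠ 0 := by positivity
  rw [discreteAdjoint_eq ψ k x rfl rfl]
  refine (abs_add_le _ _).trans (add_le_add ((abs_sub _ _).trans (add_le_add ?_ ?_)) ?_)
  · exact abs_differenceQuotient_le hψd h₁ _ hτ.ne'
  · refine (Finset.abs_sum_le_sum_abs _ _).trans (Finset.sum_le_sum fun i _ => ?_)
    refine (abs_add_le _ _).trans (add_le_add ?_ ?_) <;> rw [abs_mul]
    · have := abs_differenceQuotient_le ((hV i).differentiable (by norm_num)) (h₃ i)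
        ((k * τ, x) - ε • stUnit i) h2ε
      exact mul_le_mul this (h₀ _) (abs_nonneg _) ((abs_nonneg _).trans this)
    · have := abs_differenceQuotient_le hψd (h₄ i)
        ((k * τ, x) + τ • (1, 0) - ε • stUnit i) h2ε
      exact mul_le_mul (h₂ i _) this (abs_nonneg _) ((abs_nonneg _).trans (h₂ i 0))
  · rw [abs_mul]
    refine mul_le_mul hκ ?_ (abs_nonneg _) ((abs_nonneg _).trans hκ)
    refine (Finset.abs_sum_le_sum_abs _ _).trans (Finset.sum_le_sum fun i _ => ?_)
    exact abs_secondDifferenceQuotient_le hψ (h₅ i) _ hε.ne'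

theorem tendsto_floor_div_mul {τ : ℕ → ℝ} (hτ : ∀ n, 0 < τ n) (hτ0 : Tendsto τ atTop (𝓝 0))
    {t : ℝ} (ht : 0 ≤ t) : Tendsto (fun n => (⌊t / τ n⌋₊ : ℝ) * τ n) atTop (𝓝 t) := by
  have h1 : Tendsto (fun n => t - τ n) atTop (𝓝 t) := by simpa using hτ0.const_sub t
  refine tendsto_of_tendsto_of_tendsto_of_le_of_le h1 tendsto_const_nhds (fun n => ?_) fun n => ?_
  · have h := (div_lt_iff₀ (hτ n)).1 (Nat.lt_floor_add_one (t / τ n))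
    dsimp only
    linarith
  · exact (le_div_iff₀ (hτ n)).1 (Nat.floor_le (div_nonneg ht (hτ n).le))

theorem tendsto_discreteAdjoint (hV : ∀ i, ContDiff ℝ 1 (V i)) {ψ : ℝ × Space d → ℝ}
    (hψ : ContDiff ℝ 2 ψ) {ν : ℝ} {κ ε τ : ℕ → ℝ} (hε : ∀ n, 0 < ε n) (hτ : ∀ n, 0 < τ n)
    (hε0 : Tendsto ε atTop (𝓝 0)) (hτ0 : Tendsto τ atTop (𝓝 0)) (hκ : Tendsto κ atTop (𝓝 ν))
    {z : ℝ × Space d} (hz : 0 ≤ z.1) :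
    Tendsto (fun n => discreteAdjoint V (κ n) (ε n) (τ n) ψ ⌊z.1 / τ n⌋₊ z.2) atTop
      (𝓝 (adjointOp ν V ψ z)) := by
  let a : ℕ → ℝ × Space d := fun n => (⌊z.1 / τ n⌋₊ * τ n, z.2)
  let b : ℕ → ℝ × Space d := fun n => a n + τ n • (1, 0)
  have ha : Tendsto a atTop (𝓝 z) :=
    (tendsto_floor_div_mul hτ hτ0 hz).prodMk_nhds tendsto_const_nhds
  have hb : Tendsto b atTop (𝓝 z) := by
    simpa [b] using ha.add (hτ0.smul_const ((1, 0) : ℝ × Space d))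
  have hsub : ∀ (p : ℕ → ℝ × Space d) (i : Fin d), Tendsto p atTop (𝓝 z) →
      Tendsto (fun n => p n - ε n • stUnit i) atTop (𝓝 z) := fun p i hp => by
    simpa using hp.sub (hε0.smul_const (stUnit i))
  have hadd : ∀ (p : ℕ → ℝ × Space d) (i : Fin d), Tendsto p atTop (𝓝 z) →
      Tendsto (fun n => p n + ε n • stUnit i) atTop (𝓝 z) := fun p i hp => by
    simpa using hp.add (hε0.smul_const (stUnit i))
  have h2ε : Tendsto (fun n => 2 * ε n) atTop (𝓝 0) := by simpa using hε0.const_mul 2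
  have h2ε0 : ∀ n, 2 * ε n ≠ 0 := fun n => by have := hε n; positivity
  have hψ1 : ContDiff ℝ 1 ψ := hψ.of_le (by norm_num)
  have key : ∀ n, discreteAdjoint V (κ n) (ε n) (τ n) ψ ⌊z.1 / τ n⌋₊ z.2 = _ := fun n =>
    discreteAdjoint_eq (V := V) (κ := κ n) (ε := ε n) ψ ⌊z.1 / τ n⌋₊ z.2
      (a := a n) (b := b n) rfl rfl
  simp_rw [key]
  refine Tendsto.add (Tendsto.sub ?_ (tendsto_finsetSum _ fun i _ => Tendsto.add ?_ ?_)) ?_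
  · exact tendsto_differenceQuotient hψ1 ha hτ0 fun n => (hτ n).ne'
  · exact (tendsto_differenceQuotient (hV i) (hsub a i ha) h2ε h2ε0).mul
      ((hψ.continuous.tendsto z).comp (hadd b i hb))
  · exact (((hV i).continuous.tendsto z).comp (hsub a i ha)).mul
      (tendsto_differenceQuotient hψ1 (hsub b i hb) h2ε h2ε0)
  · exact hκ.mul (tendsto_finsetSum _ fun i _ =>
      tendsto_secondDifferenceQuotient hψ hb hε0 fun n => (hε n).ne')

/-- The scheme satisfies a weak formulation on the slab exactly, up to the last time step. -/
theorem integral_slab_scheme (hd : 1 ≤ d) (hτ : 0 < τ)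
    (hc : c = τ / (2 * ε)) (hκ : τ * κ / ε ^ 2 = 1 / (2 * d))
    (hV : ∀ i, Continuous (V i)) (hφ₀ : Continuous φ₀) {ψ : ℝ × Space d → ℝ} (hψ : IsTest ψ)
    {T : ℝ} (hT : 0 ≤ T)
    (hint : Integrable (fun z : ℝ × Space d => scheme V φ₀ c ε τ ⌊z.1 / τ⌋₊ z.2 *
      {z : ℝ × Space d | z.1 ≤ ⌊T / τ⌋₊ * τ}.indicator
        (fun z => discreteAdjoint V κ ε τ ψ ⌊z.1 / τ⌋₊ z.2) z) (slab d T)) :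
    ∫ z, scheme V φ₀ c ε τ ⌊z.1 / τ⌋₊ z.2 * {z : ℝ × Space d | z.1 ≤ ⌊T / τ⌋₊ * τ}.indicator
        (fun z => discreteAdjoint V κ ε τ ψ ⌊z.1 / τ⌋₊ z.2) z ∂slab d T
      = (∫ x, scheme V φ₀ c ε τ ⌊T / τ⌋₊ x * ψ (⌊T / τ⌋₊ * τ, x)) - ∫ x, φ₀ x * ψ (0, x) := by
  set N := ⌊T / τ⌋₊ with hN
  have hNT : N * τ ≤ T := (le_div_iff₀ hτ).1 (Nat.floor_le (div_nonneg hT hτ.le))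
  let U : ℕ → ℝ := fun k => ∫ x, scheme V φ₀ c ε τ k x * discreteAdjoint V κ ε τ ψ k x
  rw [integral_slab hT hint]
  have h1 : ∀ u : ℝ, ∫ x, scheme V φ₀ c ε τ ⌊u / τ⌋₊ x *
      {z : ℝ × Space d | z.1 ≤ N * τ}.indicator
        (fun z => discreteAdjoint V κ ε τ ψ ⌊z.1 / τ⌋₊ z.2) (u, x)
      = {t | t ≤ N * τ}.indicator (fun t => U ⌊t / τ⌋₊) u := fun u => by
    by_cases hu : u ≤ N * τ <;> simp [indicator, hu, U]
  simp_rw [h1]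
  rw [intervalIntegral.integral_indicator ⟨by positivity, hNT⟩, (integral_floor_div hτ U N).2,
    Finset.mul_sum]
  have h2 := Finset.sum_range_sub
    (fun k : ℕ => ∫ x, scheme V φ₀ c ε τ k x * ψ (k * τ, x)) N
  simp only [Nat.cast_zero, zero_mul] at h2
  rw [show scheme V φ₀ c ε τ 0 = φ₀ from rfl] at h2
  rw [← h2]
  refine Finset.sum_congr rfl fun k _ => ?_
  rw [← integral_scheme_step hd hτ hc hκ hV hφ₀ hψ k]
  push_cast
  rfl

theorem integrable_slab_indicator (B R T : ℝ) :
    Integrable (fun z : ℝ × Space d => (Metric.closedBall (0 : Space d) R).indicator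
      (fun _ => B) z.2) (slab d T) := by
  have h : Integrable ((Metric.closedBall (0 : Space d) R).indicator fun _ => B) :=
    (integrable_indicator_iff measurableSet_closedBall).2
      (integrableOn_const measure_closedBall_lt_top.ne)
  exact h.comp_snd (volume.restrict (Ioc 0 T))

theorem IsTest.exists_radius {ψ : ℝ × Space d → ℝ} (hψ : IsTest ψ) :
    ∃ R, ∀ t x, R < ‖x‖ → ψ (t, x) = 0 := by
  obtain ⟨R, hR⟩ := hψ.hasCompactSupport.isCompact.isBounded.exists_norm_le
  refine ⟨R, fun t x hx => ?_⟩
  by_contra hne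
  have h1 := hR _ (subset_tsupport _ hne)
  exact absurd ((norm_snd_le (t, x)).trans h1) (not_le.2 hx)

theorem ae_slab_mem_Ioo (T : ℝ) : ∀ᵐ z ∂slab d T, z.1 ∈ Ioo 0 T := by
  have h : ∀ᵐ t ∂volume.restrict (Ioc 0 T), t ∈ Ioo 0 T := by
    rw [← Measure.restrict_congr_set (Ioo_ae_eq_Ioc (μ := volume))]
    exact ae_restrict_mem measurableSet_Ioo
  exact Measure.quasiMeasurePreserving_fst.ae h

variable {c ε κ τ : ℕ → ℝ} {ν K : ℝ} {ψ : ℝ × Space d → ℝ}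

theorem exists_bound_discreteAdjoint (hV : ∀ i, IsTest (V i)) (hε : ∀ n, 0 < ε n)
    (hε1 : ∀ n, ε n ≤ 1) (hτ : ∀ n, 0 < τ n) (hκK : ∀ n, |κ n| ≤ K) (hψ : IsTest ψ) :
    ∃ B R, ∀ n k x, |discreteAdjoint V (κ n) (ε n) (τ n) ψ k x|
      ≤ (Metric.closedBall (0 : Space d) R).indicator (fun _ => B) x := by
  obtain ⟨B₀, -, h₀⟩ := hψ.exists_bound
  obtain ⟨B₁, -, h₁⟩ := (hψ.fderiv_apply (1, 0)).exists_bound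
  choose B₂ _ h₂ using fun i => (hV i).exists_bound
  choose B₃ _ h₃ using fun i => ((hV i).fderiv_apply (stUnit i)).exists_bound
  choose B₄ _ h₄ using fun i : Fin d => (hψ.fderiv_apply (stUnit i)).exists_bound
  choose B₅ _ h₅ using fun i : Fin d =>
    ((hψ.fderiv_apply (stUnit i)).fderiv_apply (stUnit i)).exists_bound
  obtain ⟨R, hR⟩ := hψ.exists_radius
  refine ⟨B₁ + ∑ i, (B₃ i * B₀ + B₂ i * B₄ i) + K * ∑ i, B₅ i, R + 1, fun n k x => ?_⟩
  by_cases hx : x ∈ Metric.closedBall (0 : Space d) (R + 1)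
  · rw [indicator_of_mem hx]
    exact abs_discreteAdjoint_le (hε n) (hτ n) (fun i => (hV i).contDiff_one) hψ.contDiff_two
      h₀ h₁ h₂ h₃ h₄ h₅ (hκK n) k x
  · rw [indicator_of_notMem hx]
    rw [mem_closedBall_zero_iff, not_le] at hx
    rw [discreteAdjoint_eq_zero_of_norm_lt hR
      (by rw [abs_of_pos (hε n)]; exact hε1 n) k hx, abs_zero]

theorem measurable_discreteAdjoint (hV : ∀ i, IsTest (V i)) (hψ : IsTest ψ) (n : ℕ) :
    Measurable fun z : ℝ × Space d =>
      discreteAdjoint V (κ n) (ε n) (τ n) ψ ⌊z.1 / τ n⌋₊ z.2 :=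
  measurable_floor_div (fun k => (continuous_discreteAdjoint
    (fun i => (hV i).contDiff.continuous) hψ.contDiff.continuous k).measurable) (τ n)

theorem continuous_adjointOp (hV : ∀ i, IsTest (V i)) (hψ : IsTest ψ) :
    Continuous (adjointOp ν V ψ) := by
  have h1 := (hψ.fderiv_apply (1, 0)).contDiff.continuous
  have h2 := fun i => ((hV i).fderiv_apply (stUnit i)).contDiff.continuous
  have h3 := fun i : Fin d => (hψ.fderiv_apply (stUnit i)).contDiff.continuous
  have h4 := fun i : Fin d =>
    ((hψ.fderiv_apply (stUnit i)).fderiv_apply (stUnit i)).contDiff.continuous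
  have h5 := fun i => (hV i).contDiff.continuous
  have h6 := hψ.contDiff.continuous
  unfold adjointOp
  fun_prop

theorem integrable_adjointOp (hV : ∀ i, IsTest (V i)) (hψ : IsTest ψ) (T : ℝ) :
    Integrable (adjointOp ν V ψ) (slab d T) := by
  have hs : HasCompactSupport (adjointOp ν V ψ) := by
    refine HasCompactSupport.of_support_subset_isCompact hψ.hasCompactSupport.isCompact ?_
    intro z hz
    by_contra hcon
    refine hz ?_
    have h0 : ψ z = 0 := image_eq_zero_of_notMem_tsupport hcon
    have h1 : fderiv ℝ ψ z = 0 := image_eq_zero_of_notMem_tsupport fun h =>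
      hcon (tsupport_fderiv_subset ℝ h)
    have h2 : ∀ i : Fin d, fderiv ℝ (fun y => fderiv ℝ ψ y (stUnit i)) z = 0 := fun i =>
      image_eq_zero_of_notMem_tsupport fun h => hcon (tsupport_fderiv_subset ℝ
        (closure_minimal ((support_comp_subset (g := fun A : ℝ × Space d →L[ℝ] ℝ => A (stUnit i))
          rfl (fderiv ℝ ψ)).trans (subset_tsupport _)) (isClosed_tsupport _)
          (tsupport_fderiv_subset ℝ h)))
    simp [adjointOp, h0, h1, h2]
  exact (continuous_adjointOp hV hψ).integrable_of_hasCompactSupport hs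

theorem tendsto_integral_abs_sub_slice (hψ : IsTest ψ) {t : ℕ → ℝ} {T : ℝ}
    (ht : Tendsto t atTop (𝓝 T)) :
    Tendsto (fun n => ∫ x, |ψ (T, x) - ψ (t n, x)|) atTop (𝓝 0) := by
  obtain ⟨B₀, hB₀, h₀⟩ := hψ.exists_bound
  obtain ⟨R', hR'⟩ := hψ.exists_radius
  have hψc := hψ.contDiff.continuous
  have := tendsto_integral_of_dominated_convergence (μ := (volume : Measure (Space d)))
    (F := fun n x => |ψ (T, x) - ψ (t n, x)|) (f := fun _ => 0)
    ((Metric.closedBall (0 : Space d) R').indicator fun _ => 2 * B₀)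
    (fun n => (Continuous.aestronglyMeasurable (by fun_prop)))
    ((integrable_indicator_iff measurableSet_closedBall).2
      (integrableOn_const measure_closedBall_lt_top.ne))
    (fun n => Eventually.of_forall fun x => ?_) (Eventually.of_forall fun x => ?_)
  · simpa using this
  · rw [Real.norm_eq_abs, abs_abs]
    by_cases hx : x ∈ Metric.closedBall (0 : Space d) R'
    · rw [indicator_of_mem hx]
      linarith [abs_sub (ψ (T, x)) (ψ (t n, x)), h₀ (T, x), h₀ (t n, x)]
    · rw [indicator_of_notMem hx]
      rw [mem_closedBall_zero_iff, not_le] at hx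
      rw [hR' _ x hx, hR' _ x hx, sub_zero, abs_zero]
  · have h1 : Tendsto (fun n => ψ (t n, x)) atTop (𝓝 (ψ (T, x))) :=
      (hψc.tendsto (T, x)).comp (ht.prodMk_nhds tendsto_const_nhds)
    simpa using (h1.const_sub (ψ (T, x))).abs

/-- The discrete adjoint operators of vanishing steps, cut off after the last time step, converge to
the adjoint operator in `L¹` of each slab. -/
theorem tendsto_integral_abs_discreteAdjoint_sub (hV : ∀ i, IsTest (V i)) (hε : ∀ n, 0 < ε n)
    (hε1 : ∀ n, ε n ≤ 1) (hτ : ∀ n, 0 < τ n) (hκK : ∀ n, |κ n| ≤ K)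
    (hε0 : Tendsto ε atTop (𝓝 0)) (hτ0 : Tendsto τ atTop (𝓝 0)) (hκ : Tendsto κ atTop (𝓝 ν))
    (hψ : IsTest ψ) {T : ℝ} (hT : 0 ≤ T) :
    (∀ n, Integrable ({z : ℝ × Space d | z.1 ≤ ⌊T / τ n⌋₊ * τ n}.indicator
        (fun z => discreteAdjoint V (κ n) (ε n) (τ n) ψ ⌊z.1 / τ n⌋₊ z.2)) (slab d T)) ∧
    Tendsto (fun n => ∫ z, |{z : ℝ × Space d | z.1 ≤ ⌊T / τ n⌋₊ * τ n}.indicator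
        (fun z => discreteAdjoint V (κ n) (ε n) (τ n) ψ ⌊z.1 / τ n⌋₊ z.2) z
          - adjointOp ν V ψ z| ∂slab d T) atTop (𝓝 0) := by
  obtain ⟨B, R, hBR⟩ := exists_bound_discreteAdjoint hV hε hε1 hτ hκK hψ
  set G : ℕ → ℝ × Space d → ℝ := fun n => {z : ℝ × Space d | z.1 ≤ ⌊T / τ n⌋₊ * τ n}.indicator
    (fun z => discreteAdjoint V (κ n) (ε n) (τ n) ψ ⌊z.1 / τ n⌋₊ z.2) with hG
  have hGi : ∀ n, AEStronglyMeasurable (G n) (slab d T) := fun n =>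
    ((measurable_discreteAdjoint hV hψ n).indicator
      (measurableSet_le measurable_fst measurable_const)).aestronglyMeasurable
  have hGB : ∀ n z, |G n z| ≤ (Metric.closedBall (0 : Space d) R).indicator (fun _ => B) z.2 := by
    intro n z
    by_cases hz : z ∈ {z : ℝ × Space d | z.1 ≤ ⌊T / τ n⌋₊ * τ n}
    · simp only [hG, indicator_of_mem hz]
      exact hBR n _ _
    · simp only [hG, indicator_of_notMem hz, abs_zero]
      exact (abs_nonneg _).trans (hBR 0 0 z.2)
  have hH := integrable_adjointOp (ν := ν) hV hψ T
  refine ⟨fun n => (integrable_slab_indicator B R T).mono' (hGi n) (Eventually.of_forall (hGB n)),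
    ?_⟩
  have := tendsto_integral_of_dominated_convergence (μ := slab d T)
    (F := fun n z => |G n z - adjointOp ν V ψ z|) (f := fun _ => 0)
    (fun z => (Metric.closedBall (0 : Space d) R).indicator (fun _ => B) z.2
      + |adjointOp ν V ψ z|)
    (fun n => ((hGi n).sub hH.1).norm)
    ((integrable_slab_indicator B R T).add hH.abs)
    (fun n => Eventually.of_forall fun z => ?_) ?_
  · simpa only [integral_zero] using this
  · rw [Real.norm_eq_abs, abs_abs]
    exact (abs_sub _ _).trans (add_le_add (hGB n z) le_rfl)
  · filter_upwards [ae_slab_mem_Ioo T] with z hz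
    have h1 : Tendsto (fun n => G n z) atTop (𝓝 (adjointOp ν V ψ z)) := by
      refine (tendsto_discreteAdjoint (fun i => (hV i).contDiff_one) hψ.contDiff_two hε hτ hε0
        hτ0 hκ hz.1.le).congr' ?_
      filter_upwards [(tendsto_floor_div_mul hτ hτ0 hT).eventually (lt_mem_nhds hz.2)] with n hn
      have : z ∈ {z : ℝ × Space d | z.1 ≤ ⌊T / τ n⌋₊ * τ n} := hn.le
      simp only [hG, indicator_of_mem this]
    simpa using (h1.sub_const (adjointOp ν V ψ z)).abs

/-- The scheme is an asymptotic solution as the steps tend to zero. -/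
theorem tendsto_weakDefect_scheme (hd : 1 ≤ d) (hV : ∀ i, IsTest (V i)) (hε : ∀ n, 0 < ε n)
    (hε1 : ∀ n, ε n ≤ 1) (hτ : ∀ n, 0 < τ n) (hκK : ∀ n, |κ n| ≤ K)
    (hε0 : Tendsto ε atTop (𝓝 0)) (hτ0 : Tendsto τ atTop (𝓝 0)) (hκ : Tendsto κ atTop (𝓝 ν))
    (hc : ∀ n, c n = τ n / (2 * ε n)) (hκτ : ∀ n, τ n * κ n / ε n ^ 2 = 1 / (2 * d))
    (hcV : ∀ n i z, |c n * V i z| ≤ 1 / (2 * d)) (hφ₀ : Continuous φ₀) (hφC : ∀ x, |φ₀ x| ≤ C)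
    (hψ : IsTest ψ) {T : ℝ} (hT : 0 ≤ T) :
    Tendsto (fun n => weakDefect φ₀ (fun t x => scheme V φ₀ (c n) (ε n) (τ n) ⌊t / τ n⌋₊ x) ψ
      (adjointOp ν V ψ) T) atTop (𝓝 0) := by
  have hVc : ∀ i, Continuous (V i) := fun i => (hV i).contDiff.continuous
  obtain ⟨hGint, hB⟩ :=
    tendsto_integral_abs_discreteAdjoint_sub hV hε hε1 hτ hκK hε0 hτ0 hκ hψ hT
  have hA := tendsto_integral_abs_sub_slice hψ (tendsto_floor_div_mul hτ hτ0 hT)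
  have hH := integrable_adjointOp (ν := ν) hV hψ T
  have hφn : ∀ n k x, |scheme V φ₀ (c n) (ε n) (τ n) k x| ≤ C := fun n k x =>
    abs_scheme_le hd (hcV n) hφC k x
  have hφ : ∀ n, Measurable fun z : ℝ × Space d =>
      scheme V φ₀ (c n) (ε n) (τ n) ⌊z.1 / τ n⌋₊ z.2 := fun n =>
    measurable_floor_div (fun k => (continuous_scheme hVc hφ₀ k).measurable) (τ n)
  have hAB := (hA.const_mul C).add (hB.const_mul C)
  rw [mul_zero, add_zero] at hAB
  refine squeeze_zero_norm (fun n => ?_) hAB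
  have h1 := integral_slab_scheme hd (hτ n) (hc n) (hκτ n) hVc hφ₀ hψ hT
    (integrable_bounded_mul (hφ n).aestronglyMeasurable (fun z => hφn n _ z.2) (hGint n))
  have h2 := abs_integral_mul_sub_le (hφ n).aestronglyMeasurable (fun z => hφn n _ z.2)
    (hGint n) hH
  have h3 := abs_integral_mul_sub_le (μ := volume)
    (continuous_scheme hVc hφ₀ ⌊T / τ n⌋₊).aestronglyMeasurable
    (hφn n ⌊T / τ n⌋₊) (hψ.slice T).integrable (hψ.slice (⌊T / τ n⌋₊ * τ n)).integrable
  rw [h1] at h2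
  rw [Real.norm_eq_abs, weakDefect]
  refine le_trans (le_of_eq (congrArg abs ?_)) ((abs_add_le _ _).trans (add_le_add h3 h2))
  ring

/-- The weak formulation for a smooth compactly supported vector field has a solution satisfying the
maximum principle: a limit of the monotone scheme, whose viscosity exceeds `ν` by an amount
proportional to the space step. -/
theorem exists_weakSolution_of_isTest (hd : 1 ≤ d) (hν : 0 ≤ ν) (hV : ∀ i, IsTest (V i))
    (hφ₀ : Continuous φ₀) (hC : 0 ≤ C) (hφC : ∀ x, |φ₀ x| ≤ C) :
    ∃ φ : ℝ → Space d → ℝ, Measurable (uncurry φ) ∧ (∀ t x, |φ t x| ≤ C) ∧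
      ∀ ψ, IsTest ψ → ∀ T, 0 ≤ T → weakDefect φ₀ φ ψ (adjointOp ν V ψ) T = 0 := by
  have hVc : ∀ i, Continuous (V i) := fun i => (hV i).contDiff.continuous
  choose B hB hVB using fun i => (hV i).exists_bound
  let M : ℝ := 1 + ∑ i, B i
  have hM : 0 < M := by
    have := Finset.sum_nonneg fun i (_ : i ∈ Finset.univ) => (hB i).le
    positivity
  have hVM : ∀ i z, |V i z| ≤ M := fun i z => by
    have := Finset.single_le_sum (fun i _ => (hB i).le) (Finset.mem_univ i)
    linarith [hVB i z]
  -- the excess viscosity `M * ε / 2` dominates the centred first order differences, and the time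
  -- step is such that the value at the centre enters the averages with weight zero
  let ε : ℕ → ℝ := fun n => 1 / (n + 1)
  let κ : ℕ → ℝ := fun n => ν + M * ε n / 2
  let τ : ℕ → ℝ := fun n => ε n ^ 2 / (2 * d * κ n)
  let c : ℕ → ℝ := fun n => τ n / (2 * ε n)
  have hd0 : (0 : ℝ) < d := by exact_mod_cast hd
  have hε : ∀ n, 0 < ε n := fun n => by positivity
  have hε1 : ∀ n, ε n ≤ 1 := fun n => by
    simp only [ε]
    rw [div_le_one (by positivity)]
    linarith [(Nat.cast_nonneg n : (0 : ℝ) ≤ n)]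
  have hκM : ∀ n, M * ε n / 2 ≤ κ n := fun n => by simp only [κ]; linarith
  have hκ : ∀ n, 0 < κ n := fun n =>
    lt_of_lt_of_le (by have := hε n; positivity) (hκM n)
  have hκK : ∀ n, |κ n| ≤ ν + M / 2 := fun n => by
    rw [abs_of_pos (hκ n)]
    have := mul_le_mul_of_nonneg_left (hε1 n) hM.le
    simp only [κ]
    linarith
  have hτ : ∀ n, 0 < τ n := fun n => by have := hε n; have := hκ n; positivity
  have hε0 : Tendsto ε atTop (𝓝 0) := tendsto_one_div_add_atTop_nhds_zero_nat
  have hκ0 : Tendsto κ atTop (𝓝 ν) := by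
    simpa using ((hε0.const_mul M).div_const 2).const_add ν
  have hτ_le : ∀ n, τ n ≤ ε n / (d * M) := fun n => by
    simp only [τ]
    rw [div_le_div_iff₀ (by have := hκ n; positivity) (by positivity)]
    have := mul_le_mul_of_nonneg_left (hκM n) (show 0 ≤ 2 * d * ε n by have := hε n; positivity)
    linarith [show ε n ^ 2 * (d * M) = 2 * d * ε n * (M * ε n / 2) by ring,
      show ε n * (2 * d * κ n) = 2 * d * ε n * κ n by ring]
  have hτ0 : Tendsto τ atTop (𝓝 0) :=
    squeeze_zero (fun n => (hτ n).le) hτ_le (by simpa using hε0.div_const (d * M))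
  have hκτ : ∀ n, τ n * κ n / ε n ^ 2 = 1 / (2 * d) := fun n => by
    have h1 := (hε n).ne'
    have h2 := (hκ n).ne'
    simp only [τ]
    field_simp
  have hcV : ∀ n i z, |c n * V i z| ≤ 1 / (2 * d) := fun n i z => by
    have h1 := hε n
    have h2 : 0 < c n := div_pos (hτ n) (by positivity)
    rw [abs_mul, abs_of_pos h2]
    calc c n * |V i z| ≤ c n * M := by gcongr; exact hVM i z
      _ ≤ (ε n / (d * M)) / (2 * ε n) * M := by
        simp only [c]; gcongr; exact hτ_le n
      _ = 1 / (2 * d) := by field_simp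
  exact exists_weakDefect_eq_zero
    (φ := fun n t x => scheme V φ₀ (c n) (ε n) (τ n) ⌊t / τ n⌋₊ x)
    (fun n => measurable_floor_div (fun k => (continuous_scheme hVc hφ₀ k).measurable) (τ n)) hC
    (fun n t x => abs_scheme_le hd (hcV n) hφC _ x)
    (fun ψ hψ T => integrable_adjointOp hV hψ T)
    (fun ψ hψ T hT => tendsto_weakDefect_scheme hd hV hε hε1 hτ hκK hε0 hτ0 hκ0 (fun _ => rfl)
      hκτ hcV hφ₀ hφC hψ hT)

end SmoothField

/-! ### Mollification of a divergence free field -/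

section Mollification

open scoped Convolution
open ContinuousLinearMap (lsmul lsmul_apply)

variable {E : Type*} [NormedAddCommGroup E] [NormedSpace ℝ E] [FiniteDimensional ℝ E]
  [MeasurableSpace E] [BorelSpace E] {μ : Measure E} [μ.IsAddHaarMeasure]

theorem integral_abs_convolution_normed_le (ρ : ContDiffBump (0 : E)) {f : E → ℝ}
    (hf : Integrable f μ) :
    ∫ x, |(ρ.normed μ ⋆[lsmul ℝ ℝ, μ] f) x| ∂μ ≤ ∫ x, |f x| ∂μ := by
  have h1 : Integrable (ρ.normed μ) μ := ρ.integrable_normed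
  have h2 := integral_convolution (lsmul ℝ ℝ) h1 hf.abs
  rw [ρ.integral_normed] at h2
  simp only [lsmul_apply, one_smul] at h2
  rw [← h2]
  refine integral_mono (h1.integrable_convolution (lsmul ℝ ℝ) hf).abs
    (h1.integrable_convolution (lsmul ℝ ℝ) hf.abs) fun x => ?_
  simp only [convolution_def, lsmul_apply, smul_eq_mul]
  refine (abs_integral_le_integral_abs).trans (le_of_eq (integral_congr_ae ?_))
  filter_upwards with y
  rw [abs_mul, abs_of_nonneg (ρ.nonneg_normed y)]

theorem tendsto_integral_abs_convolution_sub_of_isTest {g : E → ℝ} (hg : IsTest g) :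
    Tendsto (fun m => ∫ x, |((mollifier E m).normed μ ⋆[lsmul ℝ ℝ, μ] g) x - g x| ∂μ) atTop
      (𝓝 0) := by
  obtain ⟨B, hB, hgB⟩ := hg.exists_bound
  obtain ⟨R, hR⟩ := hg.hasCompactSupport.isCompact.isBounded.exists_norm_le
  have hgc := hg.contDiff.continuous
  have hr : ∀ m, (mollifier E m).rOut ≤ 2 := fun m => by
    change 2 / ((m : ℝ) + 1) ≤ 2
    rw [div_le_iff₀ (by positivity)]
    linarith [(Nat.cast_nonneg m : (0 : ℝ) ≤ m)]
  have hcont : ∀ m, Continuous ((mollifier E m).normed μ ⋆[lsmul ℝ ℝ, μ] g) := fun m =>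
    hg.hasCompactSupport.continuous_convolution_right (lsmul ℝ ℝ)
      (mollifier E m).continuous_normed.locallyIntegrable hgc
  have := tendsto_integral_of_dominated_convergence (μ := μ)
    (F := fun m x => |((mollifier E m).normed μ ⋆[lsmul ℝ ℝ, μ] g) x - g x|) (f := fun _ => 0)
    ((Metric.closedBall (0 : E) (R + 2)).indicator fun _ => 2 * B)
    (fun m => ((hcont m).sub hgc).abs.aestronglyMeasurable)
    ((integrable_indicator_iff measurableSet_closedBall).2
      (integrableOn_const measure_closedBall_lt_top.ne))
    (fun m => Eventually.of_forall fun x => ?_) (Eventually.of_forall fun x => ?_)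
  · simpa only [integral_zero] using this
  · rw [Real.norm_eq_abs, abs_abs]
    by_cases hx : x ∈ Metric.closedBall (0 : E) (R + 2)
    · rw [indicator_of_mem hx, ← Real.dist_eq]
      refine ContDiffBump.dist_normed_convolution_le hgc.aestronglyMeasurable fun y _ => ?_
      rw [Real.dist_eq]
      linarith [abs_sub (g y) (g x), hgB x, hgB y]
    · rw [indicator_of_notMem hx]
      rw [mem_closedBall_zero_iff, not_le] at hx
      have hzero : ∀ y ∈ Metric.ball x (mollifier E m).rOut, g y = 0 := fun y hy => by
        by_contra hne
        have h1 := hR y (subset_tsupport _ hne)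
        have h2 := norm_sub_norm_le x y
        rw [Metric.mem_ball, dist_comm, dist_eq_norm] at hy
        linarith [hr m]
      have hx0 := hzero x (Metric.mem_ball_self (mollifier E m).rOut_pos)
      rw [ContDiffBump.normed_convolution_eq_right fun y hy => by rw [hzero y hy, hx0]]
      simp
  · have h1 := ContDiffBump.convolution_tendsto_right_of_continuous (μ := μ)
      (tendsto_mollifier_rOut E) hgc x
    simpa using (h1.sub_const (g x)).abs

/-- Mollifications of an integrable function converge to it in `L¹`. -/
theorem tendsto_integral_abs_convolution_sub {w : E → ℝ} (hw : Integrable w μ) :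
    Tendsto (fun m => ∫ x, |((mollifier E m).normed μ ⋆[lsmul ℝ ℝ, μ] w) x - w x| ∂μ) atTop
      (𝓝 0) := by
  rw [Metric.tendsto_atTop]
  intro ε hε
  obtain ⟨g, hg, hwg⟩ := exists_isTest_integral_abs_sub_le hw (ε := ε / 3) (by positivity)
  have hgi : Integrable g μ := hg.integrable
  obtain ⟨N, hN⟩ := Metric.tendsto_atTop.1
    (tendsto_integral_abs_convolution_sub_of_isTest (μ := μ) hg) (ε / 3) (by positivity)
  refine ⟨N, fun m hm => ?_⟩
  have h1 := hN m hm
  rw [Real.dist_0_eq_abs, abs_of_nonneg (integral_nonneg fun _ => abs_nonneg _)] at h1 ⊢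
  set ρ := mollifier E m
  have hρ : Integrable (ρ.normed μ) μ := ρ.integrable_normed
  have h2 := integral_abs_convolution_normed_le ρ (hw.sub hgi)
  have hex : ∀ f : E → ℝ, Integrable f μ → ConvolutionExists (ρ.normed μ) f (lsmul ℝ ℝ) μ :=
    fun f hf => ρ.hasCompactSupport_normed.convolutionExists_left _ ρ.continuous_normed
      hf.locallyIntegrable
  have i1 := hρ.integrable_convolution (lsmul ℝ ℝ) hw
  have i2 := hρ.integrable_convolution (lsmul ℝ ℝ) hgi
  have i3 := hρ.integrable_convolution (lsmul ℝ ℝ) (hw.sub hgi)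
  have e : ∀ x, (ρ.normed μ ⋆[lsmul ℝ ℝ, μ] w) x
      = (ρ.normed μ ⋆[lsmul ℝ ℝ, μ] (w - g)) x + (ρ.normed μ ⋆[lsmul ℝ ℝ, μ] g) x := fun x => by
    rw [← Pi.add_apply, ← (hex _ (hw.sub hgi)).distrib_add (hex _ hgi), sub_add_cancel]
  calc ∫ x, |(ρ.normed μ ⋆[lsmul ℝ ℝ, μ] w) x - w x| ∂μ
      ≤ ∫ x, (|(ρ.normed μ ⋆[lsmul ℝ ℝ, μ] (w - g)) x|
          + |(ρ.normed μ ⋆[lsmul ℝ ℝ, μ] g) x - g x| + |w x - g x|) ∂μ := by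
        refine integral_mono (i1.sub hw).abs
          ((i3.abs.add (i2.sub hgi).abs).add (hw.sub hgi).abs) fun x => ?_
        simp only [e]
        have h := abs_add_three ((ρ.normed μ ⋆[lsmul ℝ ℝ, μ] (w - g)) x)
          ((ρ.normed μ ⋆[lsmul ℝ ℝ, μ] g) x - g x) (g x - w x)
        rw [abs_sub_comm (g x)] at h
        refine le_trans (le_of_eq (congrArg abs ?_)) h
        ring
    _ = (∫ x, |(ρ.normed μ ⋆[lsmul ℝ ℝ, μ] (w - g)) x| ∂μ)
          + (∫ x, |(ρ.normed μ ⋆[lsmul ℝ ℝ, μ] g) x - g x| ∂μ) + ∫ x, |w x - g x| ∂μ := by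
        have a1 : Integrable (fun x => |(ρ.normed μ ⋆[lsmul ℝ ℝ, μ] (w - g)) x|) μ := i3.abs
        have a2 : Integrable (fun x => |(ρ.normed μ ⋆[lsmul ℝ ℝ, μ] g) x - g x|) μ :=
          (i2.sub hgi).abs
        have a3 : Integrable (fun x => |w x - g x|) μ := (hw.sub hgi).abs
        have a4 : Integrable (fun x => |(ρ.normed μ ⋆[lsmul ℝ ℝ, μ] (w - g)) x|
          + |(ρ.normed μ ⋆[lsmul ℝ ℝ, μ] g) x - g x|) μ := a1.add a2
        rw [integral_add a4 a3, integral_add a1 a2]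
    _ < ε := by
        simp only [Pi.sub_apply] at h2
        linarith

theorem isTest_convolution (ρ : ContDiffBump (0 : E)) {w : E → ℝ} (hw : Integrable w μ)
    (hws : HasCompactSupport w) : IsTest (ρ.normed μ ⋆[lsmul ℝ ℝ, μ] w) where
  contDiff := ρ.hasCompactSupport_normed.contDiff_convolution_left _ ρ.contDiff_normed
    hw.locallyIntegrable
  hasCompactSupport := ρ.hasCompactSupport_normed.convolution _ hws

theorem fderiv_convolution_apply (ρ : ContDiffBump (0 : E)) {w : E → ℝ} (hw : Integrable w μ)
    (z e : E) : Integrable (fun y => fderiv ℝ (ρ.normed μ) (z - y) e * w y) μ ∧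
    fderiv ℝ (ρ.normed μ ⋆[lsmul ℝ ℝ, μ] w) z e
      = ∫ y, fderiv ℝ (ρ.normed μ) (z - y) e * w y ∂μ := by
  have hρ1 : ContDiff ℝ 1 (ρ.normed μ) := ρ.contDiff_normed
  have h := ρ.hasCompactSupport_normed.hasFDerivAt_convolution_left (lsmul ℝ ℝ)
    hρ1 hw.locallyIntegrable z
  have hi : Integrable (fun y => ((lsmul ℝ ℝ).precompL E) (fderiv ℝ (ρ.normed μ) (z - y)) (w y))
      μ := by
    have := (ρ.hasCompactSupport_normed.fderiv ℝ).convolutionExists_left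
      ((lsmul ℝ ℝ : ℝ →L[ℝ] ℝ →L[ℝ] ℝ).precompL E) (hρ1.continuous_fderiv (by norm_num))
      hw.locallyIntegrable z
    exact this.integrable_swap
  have e1 : ∀ y, ((lsmul ℝ ℝ).precompL E) (fderiv ℝ (ρ.normed μ) (z - y)) (w y) e
      = fderiv ℝ (ρ.normed μ) (z - y) e * w y := fun y => by
    simp [ContinuousLinearMap.precompL_apply]
  constructor
  · simpa only [e1] using hi.apply_continuousLinearMap e
  · rw [h.fderiv, convolution_eq_swap, ContinuousLinearMap.integral_apply hi]
    simp only [e1]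

end Mollification

/-! ### Locally integrable divergence free fields -/

section RoughField

open scoped Convolution
open ContinuousLinearMap (lsmul)

variable {d : ℕ} {C : ℝ}

instance isAddHaarMeasure_volume_prod : (volume : Measure (ℝ × Space d)).IsAddHaarMeasure :=
  inferInstanceAs ((volume : Measure ℝ).prod (volume : Measure (Space d))).IsAddHaarMeasure

/-- The formal adjoint operator `∂ₜψ - v·∇ψ + ν Δψ`, for a divergence free vector field `v`. -/
noncomputable def transportOp (ν : ℝ) (v : ℝ → Space d → Space d) (ψ : ℝ × Space d → ℝ)
    (z : ℝ × Space d) : ℝ :=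
  fderiv ℝ ψ z (1, 0) - fderiv ℝ ψ z (0, v z.1 z.2)
    + ν * ∑ i, fderiv ℝ (fun y => fderiv ℝ ψ y (stUnit i)) z (stUnit i)

theorem apply_space_eq_sum (A : ℝ × Space d →L[ℝ] ℝ) (u : Space d) :
    A (0, u) = ∑ i, u i * A (stUnit i) := by
  have h : ((0, u) : ℝ × Space d) = ∑ i, u i • stUnit i := by
    ext1
    · simp [Prod.fst_sum]
    · rw [Prod.snd_sum]
      ext j
      simp [Finset.sum_apply, Pi.single_apply]
  rw [h, map_sum]
  simp only [map_smul, smul_eq_mul]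

/-- The field `v` cut off outside the cylinder `[0, m + 1] × B(0, m + 3)`.  Mollifiers of radius at
most `2` do not see the lateral boundary from the points of `B(0, m)`. -/
noncomputable def truncation (v : ℝ → Space d → Space d) (m : ℕ) : ℝ × Space d → Space d :=
  (Icc (0 : ℝ) (m + 1) ×ˢ Metric.closedBall (0 : Space d) (m + 3)).indicator (uncurry v)

variable {v : ℝ → Space d → Space d}

theorem truncation_apply_of_mem {m : ℕ} {t : ℝ} {x : Space d} (ht : t ∈ Icc (0 : ℝ) (m + 1))
    (hx : ‖x‖ ≤ m + 3) : truncation v m (t, x) = v t x :=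
  indicator_of_mem (mk_mem_prod ht (mem_closedBall_zero_iff.2 hx)) _

theorem integrable_truncation
    (hv : LocallyIntegrableOn (uncurry v) (halfSpaceTime d) volume) (m : ℕ) :
    Integrable (truncation v m) volume := by
  have hK : IsCompact (Icc (0 : ℝ) (m + 1) ×ˢ Metric.closedBall (0 : Space d) (m + 3)) :=
    isCompact_Icc.prod (isCompact_closedBall _ _)
  rw [truncation, integrable_indicator_iff hK.measurableSet]
  exact hv.integrableOn_compact_subset (prod_mono Icc_subset_Ici_self (subset_univ _)) hK

theorem integrable_truncation_apply
    (hv : LocallyIntegrableOn (uncurry v) (halfSpaceTime d) volume) (m : ℕ) (i : Fin d) :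
    Integrable (fun z => truncation v m z i) volume :=
  (EuclideanSpace.proj (𝕜 := ℝ) i).integrable_comp (integrable_truncation hv m)

theorem hasCompactSupport_truncation_apply (m : ℕ) (i : Fin d) :
    HasCompactSupport fun z => truncation v m z i := by
  refine HasCompactSupport.of_support_subset_isCompact
    (K := Icc (0 : ℝ) (m + 1) ×ˢ Metric.closedBall (0 : Space d) (m + 3))
    (isCompact_Icc.prod (isCompact_closedBall _ _)) fun z hz => ?_
  by_contra hcon
  exact hz (by simp [truncation, indicator_of_notMem hcon])

/-- Mollifying the truncation in space-time preserves the vanishing of the divergence away from the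
lateral boundary: on each time slice this is the weak formulation of `∇·v = 0` with a translated
mollifier as test function. -/
theorem sum_fderiv_mollified_eq_zero
    (hv : LocallyIntegrableOn (uncurry v) (halfSpaceTime d) volume)
    (hdiv : ∀ᵐ t ∂(volume.restrict (Ici (0 : ℝ))), IsWeaklyDivFree (v t)) (m k : ℕ)
    {t : ℝ} {x : Space d} (hx : ‖x‖ ≤ m) :
    ∑ i, fderiv ℝ ((mollifier (ℝ × Space d) k).normed volume
      ⋆[lsmul ℝ ℝ, volume] fun z => truncation v m z i) (t, x) (stUnit i) = 0 := by
  set ρ := mollifier (ℝ × Space d) k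
  set r : ℝ × Space d → ℝ := ρ.normed volume with hr
  have hρ2 : ρ.rOut ≤ 2 := by
    change 2 / ((k : ℝ) + 1) ≤ 2
    rw [div_le_iff₀ (by positivity)]
    linarith [(Nat.cast_nonneg k : (0 : ℝ) ≤ k)]
  have hrt : IsTest r := ⟨ρ.contDiff_normed, ρ.hasCompactSupport_normed⟩
  have hI := fun i => fderiv_convolution_apply ρ (integrable_truncation_apply hv m i) (t, x)
    (stUnit i)
  simp only [← hr] at hI
  have e1 : ∀ y, ∑ i, fderiv ℝ r ((t, x) - y) (stUnit i) * truncation v m y i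
      = fderiv ℝ r ((t, x) - y) (0, truncation v m y) := fun y => by
    rw [apply_space_eq_sum]
    exact Finset.sum_congr rfl fun i _ => mul_comm _ _
  have hint : Integrable (fun y => fderiv ℝ r ((t, x) - y) (0, truncation v m y)) volume := by
    simp_rw [← e1]
    exact integrable_finsetSum _ fun i _ => (hI i).1
  simp_rw [fun i => (hI i).2]
  rw [← integral_finsetSum _ fun i _ => (hI i).1]
  simp_rw [e1]
  rw [Measure.volume_eq_prod] at hint ⊢
  rw [integral_prod _ hint]
  refine integral_eq_zero_of_ae ?_
  have hdiv' : ∀ᵐ s : ℝ, s ∈ Ici (0 : ℝ) → IsWeaklyDivFree (v s) :=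
    (ae_restrict_iff' measurableSet_Ici).1 hdiv
  filter_upwards [hdiv'] with s hs
  by_cases hsm : s ∈ Icc (0 : ℝ) (m + 1)
  · -- the test function `y ↦ r (t - s, x - y)` is supported in `B(x, 2)`
    let χ : Space d → ℝ := fun y => r (t - s, x - y)
    have hχ : IsTest χ := by
      refine ⟨hrt.contDiff.comp (by fun_prop), ?_⟩
      have h1 := (hrt.slice (t - s)).hasCompactSupport
      exact h1.comp_homeomorph (Homeomorph.subLeft x)
    have hχd : ∀ y u, fderiv ℝ χ y u = - fderiv ℝ r ((t, x) - (s, y)) (0, u) := fun y u => by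
      have h1 : HasFDerivAt (fun y : Space d => ((t - s, x - y) : ℝ × Space d))
          ((0 : Space d →L[ℝ] ℝ).prod (-(ContinuousLinearMap.id ℝ (Space d)))) y :=
        (hasFDerivAt_const _ _).prodMk ((hasFDerivAt_id y).const_sub x)
      have h2 : HasFDerivAt r (fderiv ℝ r (t - s, x - y)) (t - s, x - y) :=
        (hrt.contDiff_one.differentiable (by norm_num) _).hasFDerivAt
      have h3 := (HasFDerivAt.comp y h2 h1).fderiv
      change fderiv ℝ χ y = _ at h3
      rw [h3]
      simp only [ContinuousLinearMap.comp_apply, ContinuousLinearMap.prod_apply, Prod.mk_sub_mk]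
      rw [← map_neg]
      congr 1
      ext1 <;> simp
    have h0 := hs hsm.1 χ hχ
    have h2 : ∀ y, fderiv ℝ r ((t, x) - (s, y)) (0, truncation v m (s, y))
        = - fderiv ℝ χ y (v s y) := fun y => by
      rw [hχd, neg_neg]
      by_cases hy : ‖y‖ ≤ m + 3
      · rw [truncation_apply_of_mem hsm hy]
      · have : fderiv ℝ r ((t, x) - (s, y)) = 0 := by
          refine image_eq_zero_of_notMem_tsupport fun h => hy ?_
          have h4 := tsupport_fderiv_subset ℝ h
          rw [hr, ρ.tsupport_normed_eq, mem_closedBall_zero_iff] at h4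
          have h5 : ‖x - y‖ ≤ 2 := (norm_snd_le ((t, x) - (s, y))).trans (h4.trans hρ2)
          have h6 := norm_sub_norm_le y x
          rw [norm_sub_rev] at h6
          linarith
        rw [this]; simp
    simp_rw [h2]
    rw [integral_neg, h0]
    simp
  · have : ∀ y, truncation v m (s, y) = 0 := fun y =>
      indicator_of_notMem (fun h => hsm h.1) _
    simp only [this, Prod.mk_zero_zero, map_zero, integral_zero, Pi.zero_apply]

theorem slab_le_volume (T : ℝ) : slab d T ≤ volume := by
  rw [Measure.volume_eq_prod]
  exact Measure.prod_mono Measure.restrict_le_self le_rfl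

/-- A locally integrable divergence free field is approximated by smooth compactly supported fields,
in the sense that the adjoint operators converge in `L¹` of each slab. -/
theorem exists_isTest_approximation (ν : ℝ)
    (hv : LocallyIntegrableOn (uncurry v) (halfSpaceTime d) volume)
    (hdiv : ∀ᵐ t ∂(volume.restrict (Ici (0 : ℝ))), IsWeaklyDivFree (v t)) :
    ∃ V : ℕ → Fin d → ℝ × Space d → ℝ, (∀ m i, IsTest (V m i)) ∧
      ∀ ψ, IsTest ψ → ∀ T, Integrable (transportOp ν v ψ) (slab d T) ∧
        Tendsto (fun m => ∫ z, |adjointOp ν (V m) ψ z - transportOp ν v ψ z| ∂slab d T) atTop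
          (𝓝 0) := by
  let w : ℕ → Fin d → ℝ × Space d → ℝ := fun m i z => truncation v m z i
  have hw : ∀ m i, Integrable (w m i) volume := integrable_truncation_apply hv
  have hex : ∀ m, ∃ k, ∀ i, ∫ z, |((mollifier (ℝ × Space d) k).normed volume
      ⋆[lsmul ℝ ℝ, volume] w m i) z - w m i z| ≤ 1 / ((m : ℝ) + 1) := fun m =>
    (eventually_all.2 fun i => (tendsto_integral_abs_convolution_sub (hw m i)).eventually
      (ge_mem_nhds (by positivity))).exists
  choose k hk using hex
  let V : ℕ → Fin d → ℝ × Space d → ℝ := fun m i =>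
    (mollifier (ℝ × Space d) (k m)).normed volume ⋆[lsmul ℝ ℝ, volume] w m i
  have hV : ∀ m i, IsTest (V m i) := fun m i =>
    isTest_convolution _ (hw m i) (hasCompactSupport_truncation_apply m i)
  have hVw : ∀ m i, Integrable (fun z => V m i z - w m i z) volume := fun m i =>
    (hV m i).integrable.sub (hw m i)
  refine ⟨V, hV, fun ψ hψ T => ?_⟩
  obtain ⟨R, hR⟩ := hψ.exists_radius
  choose B hB hψB using fun i : Fin d => (hψ.fderiv_apply (stUnit i)).exists_bound
  obtain ⟨m₀, hm₀⟩ := exists_nat_ge (max R T)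
  -- for large `m` the truncation coincides with `v` where it matters
  have hdiff : ∀ m, m₀ ≤ m → ∀ z : ℝ × Space d, z.1 ∈ Ioo 0 T →
      adjointOp ν (V m) ψ z - transportOp ν v ψ z
        = -∑ i, (V m i z - w m i z) * fderiv ℝ ψ z (stUnit i) := by
    rintro m hm ⟨t, x⟩ hz
    have hmR : max R T ≤ m := hm₀.trans (by exact_mod_cast hm)
    simp only [adjointOp, transportOp]
    rw [apply_space_eq_sum (fderiv ℝ ψ (t, x)), Finset.sum_add_distrib, ← Finset.sum_mul]
    by_cases hx : ‖x‖ ≤ m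
    · have h1 : ∑ i, fderiv ℝ (V m i) (t, x) (stUnit i) = 0 :=
        sum_fderiv_mollified_eq_zero hv hdiv m (k m) hx
      have h2 : ∀ i, w m i (t, x) = v t x i := fun i => by
        simp only [w]
        rw [truncation_apply_of_mem ⟨hz.1.le, ?_⟩ (by linarith)]
        linarith [hz.2, le_max_right R T]
      simp only [h1, h2, sub_mul, Finset.sum_sub_distrib]
      ring
    · have hxR : R < ‖x‖ := lt_of_le_of_lt ((le_max_left R T).trans hmR) (not_le.1 hx)
      have h1 : fderiv ℝ ψ (t, x) = 0 := by
        have h : ψ =ᶠ[𝓝 (t, x)] fun _ => 0 := by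
          filter_upwards [(isOpen_lt continuous_const
            (continuous_norm.comp continuous_snd)).mem_nhds
            (show (t, x) ∈ {z : ℝ × Space d | R < ‖z.2‖} from hxR)] with z hz
          exact hR z.1 z.2 hz
        rw [h.fderiv_eq]
        simp
      simp [h1, hR t x hxR]
  have hsum : ∀ m, Integrable (fun z => ∑ i, B i * |V m i z - w m i z|) volume := fun m =>
    integrable_finsetSum _ fun i _ => ((hVw m i).abs.const_mul (B i))
  have hle : ∀ m, m₀ ≤ m → ∀ᵐ z ∂slab d T, |adjointOp ν (V m) ψ z - transportOp ν v ψ z|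
      ≤ ∑ i, B i * |V m i z - w m i z| := fun m hm => by
    filter_upwards [ae_slab_mem_Ioo T] with z hz
    rw [hdiff m hm z hz, abs_neg]
    refine (Finset.abs_sum_le_sum_abs _ _).trans (Finset.sum_le_sum fun i _ => ?_)
    rw [abs_mul, mul_comm]
    exact mul_le_mul_of_nonneg_right (hψB i z) (abs_nonneg _)
  have hD : ∀ m, m₀ ≤ m →
      Integrable (fun z => adjointOp ν (V m) ψ z - transportOp ν v ψ z) (slab d T) := fun m hm => by
    refine ((hsum m).mono_measure (slab_le_volume T)).mono' ?_ (hle m hm)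
    have h1 : AEStronglyMeasurable
        (fun z => -∑ i, (V m i z - w m i z) * fderiv ℝ ψ z (stUnit i)) (slab d T) := by
      refine (Finset.aestronglyMeasurable_fun_sum _ fun i _ => ?_).neg
      exact ((hVw m i).mono_measure (slab_le_volume T)).1.mul
        (hψ.fderiv_apply (stUnit i)).contDiff.continuous.aestronglyMeasurable
    refine h1.congr ?_
    filter_upwards [ae_slab_mem_Ioo T] with z hz
    rw [hdiff m hm z hz]
  refine ⟨?_, ?_⟩
  · have := (integrable_adjointOp (ν := ν) (hV m₀) hψ T).sub (hD m₀ le_rfl)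
    refine this.congr (Eventually.of_forall fun z => ?_)
    simp
  · have hlim : Tendsto (fun m : ℕ => (∑ i, B i) * (1 / ((m : ℝ) + 1))) atTop (𝓝 0) := by
      simpa using tendsto_one_div_add_atTop_nhds_zero_nat.const_mul (∑ i, B i)
    refine squeeze_zero' (Eventually.of_forall fun m => integral_nonneg fun _ => abs_nonneg _) ?_
      hlim
    filter_upwards [eventually_ge_atTop m₀] with m hm
    calc ∫ z, |adjointOp ν (V m) ψ z - transportOp ν v ψ z| ∂slab d T
        ≤ ∫ z, ∑ i, B i * |V m i z - w m i z| ∂slab d T :=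
          integral_mono_ae (hD m hm).abs ((hsum m).mono_measure (slab_le_volume T)) (hle m hm)
      _ ≤ ∫ z, ∑ i, B i * |V m i z - w m i z| :=
          integral_mono_measure (slab_le_volume T) (Eventually.of_forall fun z =>
            Finset.sum_nonneg fun i _ => mul_nonneg (hB i).le (abs_nonneg _)) (hsum m)
      _ = ∑ i, B i * ∫ z, |V m i z - w m i z| := by
          rw [integral_finsetSum _ fun i _ => (hVw m i).abs.const_mul (B i)]
          simp_rw [integral_const_mul]
      _ ≤ ∑ i, B i * (1 / ((m : ℝ) + 1)) :=
          Finset.sum_le_sum fun i _ => mul_le_mul_of_nonneg_left (hk m i) (hB i).le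
      _ = _ := by rw [Finset.sum_mul]

/-- The weak formulation for a locally integrable divergence free vector field has a solution
satisfying the maximum principle. -/
theorem exists_weakSolution (hd : 1 ≤ d) {ν : ℝ} (hν : 0 ≤ ν)
    (hv : LocallyIntegrableOn (uncurry v) (halfSpaceTime d) volume)
    (hdiv : ∀ᵐ t ∂(volume.restrict (Ici (0 : ℝ))), IsWeaklyDivFree (v t))
    {φ₀ : Space d → ℝ} (hφ₀ : Continuous φ₀) (hC : 0 ≤ C) (hφC : ∀ x, |φ₀ x| ≤ C) :
    ∃ φ : ℝ → Space d → ℝ, Measurable (uncurry φ) ∧ (∀ t x, |φ t x| ≤ C) ∧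
      (∀ ψ, IsTest ψ → ∀ T, Integrable (transportOp ν v ψ) (slab d T)) ∧
      ∀ ψ, IsTest ψ → ∀ T, 0 ≤ T → weakDefect φ₀ φ ψ (transportOp ν v ψ) T = 0 := by
  obtain ⟨V, hV, happ⟩ := exists_isTest_approximation ν hv hdiv
  choose φ hφ hφn hsol using fun m => exists_weakSolution_of_isTest hd hν (hV m) hφ₀ hC hφC
  obtain ⟨φ', h1, h2, h3⟩ := exists_weakDefect_eq_zero (φ₀ := φ₀) hφ hC hφn
    (fun ψ hψ T => (happ ψ hψ T).1) fun ψ hψ T hT => by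
      have hlim := ((happ ψ hψ T).2).const_mul C
      rw [mul_zero] at hlim
      refine squeeze_zero_norm (fun m => ?_) hlim
      have h4 := abs_integral_mul_sub_le (g := fun z => φ m z.1 z.2)
        (hφ m).aestronglyMeasurable (fun z => hφn m z.1 z.2)
        (integrable_adjointOp (ν := ν) (hV m) hψ T) (happ ψ hψ T).1
      refine le_trans (le_of_eq ?_) h4
      rw [Real.norm_eq_abs]
      have h5 := hsol m ψ hψ T hT
      rw [weakDefect] at h5 ⊢
      congr 1
      linarith
  exact ⟨φ', h1, h2, fun ψ hψ T => (happ ψ hψ T).1, h3⟩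

end RoughField

/-! ### From the weak formulation to distributional solutions -/

section Conclusion

variable {d : ℕ} {C : ℝ}

theorem IsTest.fderiv_slice {ψ : ℝ × Space d → ℝ} (hψ : IsTest ψ) (t : ℝ) (x u : Space d) :
    fderiv ℝ (fun y => ψ (t, y)) x u = fderiv ℝ ψ (t, x) (0, u) := by
  have h1 : HasFDerivAt (fun y : Space d => ((t, y) : ℝ × Space d))
      ((0 : Space d →L[ℝ] ℝ).prod (ContinuousLinearMap.id ℝ (Space d))) x :=
    (hasFDerivAt_const _ _).prodMk (hasFDerivAt_id x)
  have h2 : HasFDerivAt ψ (fderiv ℝ ψ (t, x)) (t, x) :=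
    (hψ.contDiff_one.differentiable (by norm_num) _).hasFDerivAt
  have h3 := (HasFDerivAt.comp x h2 h1).fderiv
  change fderiv ℝ (fun y => ψ (t, y)) x = _ at h3
  rw [h3]
  simp

theorem IsTest.deriv_time {ψ : ℝ × Space d → ℝ} (hψ : IsTest ψ) (t : ℝ) (x : Space d) :
    deriv (fun s => ψ (s, x)) t = fderiv ℝ ψ (t, x) (1, 0) := by
  have h2 : HasFDerivAt ψ (fderiv ℝ ψ (t, x)) (t, x) :=
    (hψ.contDiff_one.differentiable (by norm_num) _).hasFDerivAt
  exact (h2.comp_hasDerivAt t ((hasDerivAt_id t).prodMk (hasDerivAt_const t x))).deriv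

theorem IsTest.laplacian_slice {ψ : ℝ × Space d → ℝ} (hψ : IsTest ψ) (t : ℝ) (x : Space d) :
    Laplacian.laplacian (fun y => ψ (t, y)) x
      = ∑ i, fderiv ℝ (fun y => fderiv ℝ ψ y (stUnit i)) (t, x) (stUnit i) := by
  rw [congrFun (InnerProductSpace.laplacian_eq_iteratedFDeriv_orthonormalBasis
    (fun y => ψ (t, y)) (EuclideanSpace.basisFun (Fin d) ℝ)) x]
  refine Finset.sum_congr rfl fun i _ => ?_
  rw [iteratedFDeriv_two_apply]
  simp only [EuclideanSpace.basisFun_apply, Matrix.cons_val_zero, Matrix.cons_val_one]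
  have hd : DifferentiableAt ℝ (fderiv ℝ fun y => ψ (t, y)) x :=
    ((hψ.slice t).contDiff_two.fderiv_right (m := 1) (by norm_num)).differentiable
      (by norm_num) x
  have h1 : fderiv ℝ (fun y => fderiv ℝ (fun y => ψ (t, y)) y (unit i)) x (unit i)
      = fderiv ℝ (fderiv ℝ fun y => ψ (t, y)) x (unit i) (unit i) := by
    rw [fderiv_clm_apply hd (differentiableAt_const _)]
    simp
  rw [← h1]
  simp_rw [hψ.fderiv_slice]
  exact (hψ.fderiv_apply (stUnit i)).fderiv_slice t x (unit i)

theorem transportOp_eq (ν : ℝ) (v : ℝ → Space d → Space d) {ψ : ℝ × Space d → ℝ} (hψ : IsTest ψ)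
    (t : ℝ) (x : Space d) :
    deriv (fun s : ℝ => ψ (s, x)) t - fderiv ℝ (fun y : Space d => ψ (t, y)) x (v t x)
      + ν * Laplacian.laplacian (fun y : Space d => ψ (t, y)) x = transportOp ν v ψ (t, x) := by
  rw [hψ.deriv_time, hψ.fderiv_slice, hψ.laplacian_slice, transportOp]

theorem isDistributionalSolution_of_weakDefect {ν : ℝ} {v : ℝ → Space d → Space d}
    (hv : LocallyIntegrableOn (uncurry v) (halfSpaceTime d) volume) {φ₀ : Space d → ℝ}
    (hφ₀ : IsTest φ₀) {φ : ℝ → Space d → ℝ} (hφ : Measurable (uncurry φ))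
    (hφC : ∀ t x, |φ t x| ≤ C)
    (hint : ∀ ψ, IsTest ψ → ∀ T, Integrable (transportOp ν v ψ) (slab d T))
    (hsol : ∀ ψ, IsTest ψ → ∀ T, 0 ≤ T → weakDefect φ₀ φ ψ (transportOp ν v ψ) T = 0) :
    IsDistributionalSolution ν v φ₀ φ := by
  have hslice : ∀ t, LocallyIntegrable (φ t) volume := fun t =>
    (locallyIntegrable_const C).mono (hφ.comp measurable_prodMk_left).aestronglyMeasurable
      (Eventually.of_forall fun x => (hφC t x).trans (le_abs_self C))
  have hφi : ∀ ψ, IsTest ψ → ∀ T, Integrable (fun z => φ z.1 z.2 * transportOp ν v ψ z)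
      (slab d T) := fun ψ hψ T =>
    integrable_bounded_mul (g := fun z => φ z.1 z.2) hφ.aestronglyMeasurable
      (fun z => hφC z.1 z.2) (hint ψ hψ T)
  refine ⟨?_, ?_, fun t _ => hslice t, ?_, ?_, ?_⟩
  · exact ((locallyIntegrable_const C).mono hφ.aestronglyMeasurable
      (Eventually.of_forall fun z => (hφC z.1 z.2).trans (le_abs_self C))).locallyIntegrableOn _
  · intro z hz
    obtain ⟨s, hs, hvs⟩ := hv z hz
    refine ⟨s, hs, (hvs.norm.const_mul C).mono' (hφ.aestronglyMeasurable.smul hvs.1)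
      (Eventually.of_forall fun z => ?_)⟩
    rw [norm_smul]
    exact mul_le_mul_of_nonneg_right (hφC z.1 z.2) (norm_nonneg _)
  · intro χ hχ t ht
    have ht : 0 ≤ t := ht
    obtain ⟨ψ, hψ, hψχ⟩ := hχ.exists_extension (t + 1)
    have hcont : ContinuousOn (fun s => (∫ x, φ₀ x * ψ (0, x))
        + ∫ u in (0 : ℝ)..s, ∫ x, φ u x * transportOp ν v ψ (u, x)) (Icc 0 (t + 1)) := by
      refine continuousOn_const.add ?_
      have := intervalIntegral.continuousOn_primitive_interval (μ := volume)
        (f := fun u => ∫ x, φ u x * transportOp ν v ψ (u, x)) (a := 0) (b := t + 1) (by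
          rw [uIcc_of_le (by linarith), integrableOn_Icc_iff_integrableOn_Ioc]
          exact (hφi ψ hψ (t + 1)).integral_prod_left)
      rwa [uIcc_of_le (by linarith)] at this
    have hcont' : ContinuousOn (fun s => ∫ x, φ s x * χ x) (Icc 0 (t + 1)) := by
      refine hcont.congr fun s hs => ?_
      have h1 := hsol ψ hψ s hs.1
      rw [weakDefect, integral_slab hs.1 (hφi ψ hψ s)] at h1
      simp_rw [hψχ s ⟨by linarith [hs.1], hs.2⟩] at h1
      linarith
    refine (hcont' t ⟨ht, by linarith⟩).mono_of_mem_nhdsWithin ?_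
    rw [← Ici_inter_Iic]
    exact inter_mem self_mem_nhdsWithin (mem_nhdsWithin_of_mem_nhds (Iic_mem_nhds (by linarith)))
  · refine ae_eq_of_integral_contDiff_smul_eq (hslice 0)
      hφ₀.contDiff.continuous.locallyIntegrable fun χ hχ hχs => ?_
    obtain ⟨ψ, hψ, hψχ⟩ := (IsTest.mk hχ hχs).exists_extension 0
    have h1 := hsol ψ hψ 0 le_rfl
    have h2 : slab d 0 = 0 := by simp [slab]
    rw [weakDefect, h2, integral_zero_measure] at h1
    simp_rw [hψχ 0 (by simp)] at h1
    simp only [smul_eq_mul, mul_comm (χ _)]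
    linarith
  · intro ψ hψ T hT
    have h1 := hsol ψ hψ T hT.le
    rw [weakDefect, integral_slab hT.le (hφi ψ hψ T)] at h1
    simp_rw [transportOp_eq ν v hψ]
    linarith

theorem abs_le_toReal_eLpNorm_top {f : Space d → ℝ} (hf : IsTest f) (x : Space d) :
    |f x| ≤ (eLpNorm f ⊤ volume).toReal := by
  have hfin : eLpNorm f ⊤ volume ≠ ⊤ :=
    (hf.contDiff.continuous.memLp_of_hasCompactSupport hf.hasCompactSupport).eLpNorm_ne_top
  have hae : ∀ᵐ y, |f y| ≤ (eLpNorm f ⊤ volume).toReal := by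
    rw [eLpNorm_exponent_top] at hfin ⊢
    filter_upwards [ae_le_eLpNormEssSup (f := f) (μ := volume)] with y hy
    have := ENNReal.toReal_mono hfin hy
    simpa using this
  by_contra! hlt
  have hopen : IsOpen {y | (eLpNorm f ⊤ volume).toReal < |f y|} :=
    isOpen_lt continuous_const hf.contDiff.continuous.abs
  have hzero : volume {y | (eLpNorm f ⊤ volume).toReal < |f y|} = 0 := by
    simpa [ae_iff] using hae
  exact notMem_empty x ((hopen.eq_empty_of_measure_zero hzero).subset hlt)

end Conclusion

end AdjointTransport

theorem mainTheorem2 (d : ℕ) (hd : 1 ≤ d) (ν : ℝ) (hν : 0 ≤ ν)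
    (p q p' q' : ℝ≥0∞) (hp : p.HolderConjugate p') (hq : q.HolderConjugate q')
    (v : ℝ → AdjointTransport.Space d → AdjointTransport.Space d)
    (hv : AdjointTransport.MemLpHomSobolev p' q' v)
    (hdiv : ∀ᵐ t ∂(volume.restrict (Ici (0 : ℝ))), AdjointTransport.IsWeaklyDivFree (v t))
    (φ₀ : AdjointTransport.Space d → ℝ) (hφ₀ : AdjointTransport.IsTest φ₀) :
    ∃ φ : ℝ → AdjointTransport.Space d → ℝ,
      MemLp (Function.uncurry φ) ∞ (volume.restrict (AdjointTransport.halfSpaceTime d)) ∧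
      AdjointTransport.IsDistributionalSolution ν v φ₀ φ ∧
      ∀ t : ℝ, 0 ≤ t → eLpNorm (φ t) ∞ volume ≤ eLpNorm φ₀ ∞ volume := by
  have hbound := AdjointTransport.abs_le_toReal_eLpNorm_top hφ₀
  obtain ⟨φ, hφ, hφC, hint, hsol⟩ := AdjointTransport.exists_weakSolution hd hν
    hv.locallyIntegrableOn hdiv hφ₀.contDiff.continuous ENNReal.toReal_nonneg hbound
  refine ⟨φ, memLp_top_of_bound hφ.aestronglyMeasurable _ (Filter.Eventually.of_forall fun z =>
    hφC z.1 z.2), AdjointTransport.isDistributionalSolution_of_weakDefect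
      hv.locallyIntegrableOn hφ₀ hφ hφC hint hsol, fun t _ => ?_⟩
  have hfin : eLpNorm φ₀ ⊤ volume ≠ ⊤ :=
    (hφ₀.contDiff.continuous.memLp_of_hasCompactSupport hφ₀.hasCompactSupport).eLpNorm_ne_top
  rw [← ENNReal.ofReal_toReal hfin, eLpNorm_exponent_top]
  exact eLpNormEssSup_le_of_ae_bound (Filter.Eventually.of_forall fun x => hφC t x)
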